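/- Let $I\subset\mathbb R$ be a bounded nondegenerate interval, and for an interval $J$ let $D(J)$ be the family of its dyadic subintervals ($J$ itself, its two halves, their halves, and so on). Write $\langle f\rangle_J=\frac1{|J|}\int_J f\,dt$. Let $0\le m\le M<\infty$. For real $x=(x_1,x_2,x_3)$ with $x_1^2\le x_2$ and $m\le x_3\le M$ put $$ \mathbf B_{CET}(x;m,M)=\sup\frac1{|I|}\Big\{\int_I|\phi|^2\,d\mu+\sum_{J\in D(I)}|\langle\phi\rangle_J|^2\alpha_J\Big\}, $$ where the supremum is over all real-valued $\phi\in L^2(I)$, all nonnegative measures $\mu$ on $I$ without atoms, and all families $(\alpha_J)_{J\in D(I)}$ of nonnegative numbers such that $$ \langle\phi\rangle_I=x_1,\qquad \langle\phi^2\rangle_I=x_2,\qquad \frac1{|I|}\Big(\mu(I)+\sum_{J\in D(I)}\alpha_J\Big)=x_3, $$ $$ m|J|\le\mu(J)+\sum_{\ell\in D(J)}\alpha_\ell\le M|J|\qquad\text{for all }J\in D(I). $$ **Theorem.** (i) Suppose $m<x_3\le M$ and $x_1^2\le x_2$. If $x_2>0$, then the equation $$ \frac{x_1^2}{x_2}=\left[\frac{1-2a(M-x_3)}{1-2a(M-m)}\right]^2\frac{1-4a(M-m)}{1-4a(M-x_3)}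 $$ has a unique solution $a=a(x)$ in the interval $\big[0,\frac1{4(M-m)}\big]$, and $$ \mathbf B_{CET}(x;m,M)=\frac{(x_3-m)\,x_2}{[1-2a(M-m)]^2\,[1-4a(M-x_3)]}+m\,x_2 . $$ If $x_2=0$ (so $x_1=0$), then $\mathbf B_{CET}(x;m,M)=0$. (ii) If $x_3=m$ and $x_1^2\le x_2$, then $\mathbf B_{CET}(x;m,M)=m\,x_2$. In particular, $\mathbf B_{CET}(x;m,M)$ is finite and does not depend on the interval $I$. -/

import Mathlib

open MeasureTheory Set
open scoped NNReal ENNReal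

/-- The endpoints of the dyadic subinterval of `[u, v)` with address `σ`: the empty word is the
interval itself, and each letter passes to the left (`false`) or right (`true`) half. As `σ` runs
over all words this enumerates the dyadic lattice `D([u, v))` without repetition (if `u < v`), and
the dyadic subintervals of the interval with address `σ` are those with addresses `σ ++ τ`. -/
noncomputable def dyadicEnds (u v : ℝ) : List Bool → ℝ × ℝ
  | [] => (u, v)
  | false :: σ => dyadicEnds u ((u + v) / 2) σ
  | true :: σ => dyadicEnds ((u + v) / 2) v σ

/-- The dyadic subinterval of `I = [u, v)` with address `σ`. (All measures below have no atoms, so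
which endpoints belong to the intervals is immaterial.) -/
def dyadicInterval (u v : ℝ) (σ : List Bool) : Set ℝ :=
  Ico (dyadicEnds u v σ).1 (dyadicEnds u v σ).2

/-- The mass `μ(J) + ∑_{ℓ ∈ D(J)} α_ℓ`, where `J` is the dyadic interval with address `σ`. -/
noncomputable def cetMass (u v : ℝ) (μ : Measure ℝ) (α : List Bool → ℝ≥0) (σ : List Bool) :
    ℝ≥0∞ :=
  μ (dyadicInterval u v σ) + ∑' τ : List Bool, (α (σ ++ τ) : ℝ≥0∞)

/-- The triples `(φ, μ, α)` over which the supremum in the Bellman function is taken: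
`φ ∈ L²(I)` is real valued, `μ` is a measure without atoms on `I = [u, v)`, and `α` is a family of
nonnegative numbers indexed by the dyadic subintervals of `I`. -/
structure CetAdmissible (u v m M x₁ x₂ x₃ : ℝ) (φ : ℝ → ℝ) (μ : Measure ℝ)
    (α : List Bool → ℝ≥0) : Prop where
  memLp : MemLp φ 2 (volume.restrict (Ico u v))
  noAtoms : ∀ t : ℝ, μ {t} = 0
  supported : μ (Ico u v)ᶜ = 0
  average : ⨍ t in Ico u v, φ t = x₁
  average_sq : ⨍ t in Ico u v, φ t ^ 2 = x₂
  mass : cetMass u v μ α [] / volume (Ico u v) = ENNReal.ofReal x₃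
  lower : ∀ σ : List Bool,
    ENNReal.ofReal m * volume (dyadicInterval u v σ) ≤ cetMass u v μ α σ
  upper : ∀ σ : List Bool,
    cetMass u v μ α σ ≤ ENNReal.ofReal M * volume (dyadicInterval u v σ)

/-- The quantity to be maximised,
`|I|⁻¹ (∫_I |φ|² dμ + ∑_{J ∈ D(I)} |⟨φ⟩_J|² α_J)`, as an extended nonnegative real. -/
noncomputable def cetFunctional (u v : ℝ) (φ : ℝ → ℝ) (μ : Measure ℝ)
    (α : List Bool → ℝ≥0) : ℝ≥0∞ :=
  ((∫⁻ t in Ico u v, ENNReal.ofReal (φ t ^ 2) ∂μ) +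
    ∑' σ : List Bool, ENNReal.ofReal ((⨍ t in dyadicInterval u v σ, φ t) ^ 2) * (α σ : ℝ≥0∞)) /
    volume (Ico u v)

/-- The Bellman function of the dyadic Carleson embedding theorem on the interval `I = [u, v)`. -/
noncomputable def cetBellman (u v x₁ x₂ x₃ m M : ℝ) : ℝ≥0∞ :=
  sSup {y : ℝ≥0∞ | ∃ (φ : ℝ → ℝ) (μ : Measure ℝ) (α : List Bool → ℝ≥0),
    CetAdmissible u v m M x₁ x₂ x₃ φ μ α ∧ y = cetFunctional u v φ μ α}

/-- `a` lies in `[0, 1 / (4 (M - m))]` and solves the cubic equation. -/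
def IsCetRoot (x₁ x₂ x₃ m M a : ℝ) : Prop :=
  a ∈ Icc 0 (1 / (4 * (M - m))) ∧
    x₁ ^ 2 / x₂ = ((1 - 2 * a * (M - x₃)) / (1 - 2 * a * (M - m))) ^ 2 *
      ((1 - 4 * a * (M - m)) / (1 - 4 * a * (M - x₃)))

/-- The explicit expression in terms of `x` and the parameter `a`. -/
noncomputable def cetFormula (x₂ x₃ m M a : ℝ) : ℝ :=
  (x₃ - m) * x₂ / ((1 - 2 * a * (M - m)) ^ 2 * (1 - 4 * a * (M - x₃))) + m * x₂

open Filter Topology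

/-! ### Sums over the binary tree -/

/-! The Bellman function is squeezed between explicit majorants and explicit constructions.

Upper bound. For `0 < z < 1/(M-m)` the function `m x₂ + x₂/(z(1-z(M-m))) - x₁²/(z(1-z(M-x₃)))` is
concave, being linear in `x₂` minus a quotient (square over affine), and its `x₃`-derivative is at
least `x₁²`. So it absorbs one bisection of `I` together with the term of `α` at `I`
(`cetMajorant_step`), and it dominates the functional when `φ` is replaced by its mean
(`mul_sq_le_cetMajorant`). Induction over generations, then Fatou and Lebesgue differentiation, give
`cetFunctional_le`; differentiation is usable `μ`-a.e. because the mass bounds force `μ` to be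
absolutely continuous. The cubic equation is the stationarity condition in `z`, with `z = 2a`; there
the majorant equals the formula. The root `a = 0` occurs only for `x₁² = x₂` and is reached as `z →
0`.

Lower bound. Attainable values are closed under scaling of `φ`, gluing of halves with extra mass on
the parent, and limits (`CetReach.smul`, `CetReach.concat`, `CetBelow.of_tendsto`), hence under
arbitrary convex combinations (`CetBelow.convex_comb`). On the face `x₃ = M`, a self-similar
construction puts a small mass on `I`, and covers most of `I` by rescaled copies of itself and the
rest by density `m` (`cetBelow_top_step`). A general point lies on a segment from that face to the
face `x₃ = m`, along which the formula is linear. -/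

theorem tsum_list_bool (F : List Bool → ℝ≥0∞) :
    ∑' σ, F σ = F [] + (∑' σ, F (false :: σ) + ∑' σ, F (true :: σ)) := by
  have hb : Function.Bijective (Sum.elim (fun _ : Unit => ([] : List Bool))
      (fun p : Σ _ : Bool, List Bool => p.1 :: p.2)) := by
    constructor
    · rintro (_ | ⟨b, σ⟩) (_ | ⟨b', σ'⟩) h <;> simp_all
    · rintro (_ | ⟨b, σ⟩)
      · exact ⟨Sum.inl (), rfl⟩
      · exact ⟨Sum.inr ⟨b, σ⟩, rfl⟩
  rw [← (Equiv.ofBijective _ hb).tsum_eq, Summable.tsum_sum ENNReal.summable ENNReal.summable]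
  congr 1
  · simp
  · rw [ENNReal.tsum_sigma', tsum_bool]
    rfl

/-- The sum of `F` over the words of length less than `n`. -/
noncomputable def treeSum : ℕ → (List Bool → ℝ≥0∞) → ℝ≥0∞
  | 0, _ => 0
  | n + 1, F => F [] + (treeSum n (fun σ => F (false :: σ)) + treeSum n (fun σ => F (true :: σ)))

theorem treeSum_eq_tsum (n : ℕ) (F : List Bool → ℝ≥0∞) :
    treeSum n F = ∑' σ : List Bool, if σ.length < n then F σ else 0 := by
  induction n generalizing F with
  | zero => simp [treeSum]
  | succ n ih =>
    rw [tsum_list_bool, treeSum, ih, ih]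
    simp

theorem tsum_le_iSup_treeSum (F : List Bool → ℝ≥0∞) : ∑' σ, F σ ≤ ⨆ n, treeSum n F := by
  rw [ENNReal.tsum_eq_iSup_sum]
  refine iSup_le fun s => le_iSup_of_le (s.sup List.length + 1) ?_
  rw [treeSum_eq_tsum]
  refine le_trans (Finset.sum_le_sum fun σ hσ => ?_) (ENNReal.sum_le_tsum s)
  have : σ.length ≤ s.sup List.length := Finset.le_sup (f := List.length) hσ
  rw [if_pos (by omega)]

theorem treeSum_mono (F : List Bool → ℝ≥0∞) : Monotone fun n => treeSum n F := by
  intro n k hnk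
  simp only [treeSum_eq_tsum]
  refine ENNReal.tsum_le_tsum fun σ => ?_
  split_ifs <;> first | omega | simp

/-! ### Dyadic intervals -/

theorem dyadicInterval_nil (u v : ℝ) : dyadicInterval u v [] = Ico u v := rfl

theorem dyadicInterval_false (u v : ℝ) (σ : List Bool) :
    dyadicInterval u v (false :: σ) = dyadicInterval u ((u + v) / 2) σ := rfl

theorem dyadicInterval_true (u v : ℝ) (σ : List Bool) :
    dyadicInterval u v (true :: σ) = dyadicInterval ((u + v) / 2) v σ := rfl

theorem dyadicInterval_subset {u v : ℝ} (huv : u ≤ v) (σ : List Bool) :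
    dyadicInterval u v σ ⊆ Ico u v := by
  induction σ generalizing u v with
  | nil => rfl
  | cons b σ ih =>
    cases b
    · exact (ih (by linarith)).trans (Ico_subset_Ico_right (by linarith))
    · exact (ih (by linarith)).trans (Ico_subset_Ico_left (by linarith))

theorem measurableSet_dyadicInterval (u v : ℝ) (σ : List Bool) :
    MeasurableSet (dyadicInterval u v σ) := measurableSet_Ico

theorem cetMass_false (u v : ℝ) (μ : Measure ℝ) (α : List Bool → ℝ≥0) (σ : List Bool) :
    cetMass u v μ α (false :: σ) = cetMass u ((u + v) / 2) μ (fun τ => α (false :: τ)) σ := rfl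

theorem cetMass_true (u v : ℝ) (μ : Measure ℝ) (α : List Bool → ℝ≥0) (σ : List Bool) :
    cetMass u v μ α (true :: σ) = cetMass ((u + v) / 2) v μ (fun τ => α (true :: τ)) σ := rfl

theorem Ico_union_half {u v : ℝ} (huv : u ≤ v) :
    Ico u ((u + v) / 2) ∪ Ico ((u + v) / 2) v = Ico u v :=
  Ico_union_Ico_eq_Ico (by linarith) (by linarith)

theorem Ico_disjoint_half (u v : ℝ) : Disjoint (Ico u ((u + v) / 2)) (Ico ((u + v) / 2) v) :=
  Ico_disjoint_Ico_same

theorem cetMass_nil {u v : ℝ} (huv : u ≤ v) (μ : Measure ℝ) (α : List Bool → ℝ≥0) :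
    cetMass u v μ α [] = α [] + (cetMass u v μ α [false] + cetMass u v μ α [true]) := by
  simp only [cetMass, List.nil_append, List.cons_append, dyadicInterval_nil, dyadicInterval_false,
    dyadicInterval_true]
  rw [tsum_list_bool, ← Ico_union_half huv, measure_union (Ico_disjoint_half u v) measurableSet_Ico]
  ring

/-- The endpoints of the dyadic subinterval of `[u, v)` of generation `n` that contains `t`. -/
noncomputable def dyadicAt : ℕ → ℝ → ℝ → ℝ → ℝ × ℝ
  | 0, u, v, _ => (u, v)
  | n + 1, u, v, t =>
    if t < (u + v) / 2 then dyadicAt n u ((u + v) / 2) t else dyadicAt n ((u + v) / 2) v t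

theorem dyadicAt_spec (n : ℕ) {u v t : ℝ} (ht : t ∈ Ico u v) :
    t ∈ Ico (dyadicAt n u v t).1 (dyadicAt n u v t).2 ∧
    Ico (dyadicAt n u v t).1 (dyadicAt n u v t).2 ⊆ Ico u v ∧
    (dyadicAt n u v t).2 - (dyadicAt n u v t).1 = (v - u) / 2 ^ n := by
  induction n generalizing u v with
  | zero => simp [dyadicAt, ht.1, ht.2]
  | succ n ih =>
    obtain ⟨h1, h2⟩ := ht
    rw [dyadicAt]
    split_ifs with h
    · obtain ⟨h3, h4, h5⟩ := ih (u := u) (v := (u + v) / 2) ⟨h1, h⟩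
      refine ⟨h3, h4.trans (Ico_subset_Ico_right (by linarith)), ?_⟩
      rw [h5, pow_succ]; field_simp; ring
    · obtain ⟨h3, h4, h5⟩ := ih (u := (u + v) / 2) (v := v) ⟨not_lt.1 h, h2⟩
      refine ⟨h3, h4.trans (Ico_subset_Ico_left (by linarith)), ?_⟩
      rw [h5, pow_succ]; field_simp; ring

theorem dyadicAt_left (n : ℕ) {u v t : ℝ} (h : t < (u + v) / 2) :
    dyadicAt (n + 1) u v t = dyadicAt n u ((u + v) / 2) t := by rw [dyadicAt, if_pos h]

theorem dyadicAt_right (n : ℕ) {u v t : ℝ} (h : (u + v) / 2 ≤ t) :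
    dyadicAt (n + 1) u v t = dyadicAt n ((u + v) / 2) v t := by rw [dyadicAt, if_neg h.not_gt]

theorem tendsto_dyadicAt {u v t : ℝ} (ht : t ∈ Ico u v) :
    Tendsto (fun n => (dyadicAt n u v t).2 - (dyadicAt n u v t).1) atTop (𝓝[>] 0) := by
  have huv : 0 < v - u := by linarith [ht.1, ht.2]
  simp only [(dyadicAt_spec _ ht).2.2]
  refine tendsto_nhdsWithin_iff.2 ⟨?_, Eventually.of_forall fun n => ?_⟩
  · simp only [div_eq_mul_inv, ← inv_pow]
    have := (tendsto_pow_atTop_nhds_zero_of_lt_one (r := (2 : ℝ)⁻¹) (by norm_num)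
      (by norm_num)).const_mul (v - u)
    simpa using this
  · exact div_pos huv (by positivity)

/-- The points of `[u, v)` whose dyadic interval of generation `n` lies in `U`. -/
def dyadicInner (u v : ℝ) (U : Set ℝ) (n : ℕ) : Set ℝ :=
  {t | t ∈ Ico u v ∧ Ico (dyadicAt n u v t).1 (dyadicAt n u v t).2 ⊆ U}

theorem dyadicInner_succ {u v : ℝ} (huv : u ≤ v) (U : Set ℝ) (n : ℕ) :
    dyadicInner u v U (n + 1) =
      dyadicInner u ((u + v) / 2) U n ∪ dyadicInner ((u + v) / 2) v U n := by
  ext t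
  rcases lt_or_ge t ((u + v) / 2) with h | h
  · have : t < v := by linarith
    simp [dyadicInner, dyadicAt_left n h, h, this, h.not_ge]
  · have : u ≤ t := by linarith
    simp [dyadicInner, dyadicAt_right n h, h, this, h.not_gt]

theorem dyadicInner_subset_succ {u v : ℝ} (huv : u ≤ v) (U : Set ℝ) (n : ℕ) :
    dyadicInner u v U n ⊆ dyadicInner u v U (n + 1) := by
  induction n generalizing u v with
  | zero =>
    rintro t ⟨ht, h⟩
    exact ⟨ht, (dyadicAt_spec _ ht).2.1.trans h⟩
  | succ n ih =>
    rw [dyadicInner_succ huv, dyadicInner_succ huv]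
    exact union_subset_union (ih (by linarith)) (ih (by linarith))

theorem measurableSet_dyadicInner {u v : ℝ} (huv : u ≤ v) (U : Set ℝ) (n : ℕ) :
    MeasurableSet (dyadicInner u v U n) := by
  induction n generalizing u v with
  | zero => exact measurableSet_Ico.inter (MeasurableSet.const (Ico u v ⊆ U))
  | succ n ih =>
    rw [dyadicInner_succ huv]
    exact (ih (by linarith)).union (ih (by linarith))

theorem measure_dyadicInner_le {u v : ℝ} (huv : u ≤ v) (U : Set ℝ) {μ : Measure ℝ} {C : ℝ≥0∞}
    (hμ : ∀ σ, μ (dyadicInterval u v σ) ≤ C * volume (dyadicInterval u v σ)) (n : ℕ) :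
    μ (dyadicInner u v U n) ≤ C * volume (dyadicInner u v U n) := by
  induction n generalizing u v with
  | zero =>
    by_cases h : Ico u v ⊆ U
    · have : dyadicInner u v U 0 = Ico u v := by ext; simp [dyadicInner, dyadicAt, h]
      rw [this]
      exact hμ []
    · have : dyadicInner u v U 0 = ∅ := by ext; simp [dyadicInner, dyadicAt, h]
      simp [this]
  | succ n ih =>
    have h1 : u ≤ (u + v) / 2 := by linarith
    have h2 : (u + v) / 2 ≤ v := by linarith
    have hd : Disjoint (dyadicInner u ((u + v) / 2) U n) (dyadicInner ((u + v) / 2) v U n) :=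
      (Ico_disjoint_half u v).mono (fun _ h => And.left h) (fun _ h => And.left h)
    rw [dyadicInner_succ huv, measure_union hd (measurableSet_dyadicInner h2 U n),
      measure_union hd (measurableSet_dyadicInner h2 U n), mul_add]
    exact add_le_add (ih h1 fun σ => hμ (false :: σ)) (ih h2 fun σ => hμ (true :: σ))

theorem iUnion_dyadicInner {u v : ℝ} {U : Set ℝ} (hU : IsOpen U) :
    ⋃ n, dyadicInner u v U n = Ico u v ∩ U := by
  ext t
  simp only [mem_iUnion]
  constructor
  · rintro ⟨n, h1, h2⟩
    exact ⟨h1, h2 (dyadicAt_spec n h1).1⟩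
  · rintro ⟨h1, h2⟩
    obtain ⟨ε, hε, hb⟩ := Metric.isOpen_iff.1 hU t h2
    obtain ⟨n, hn⟩ := (((tendsto_dyadicAt h1).mono_right nhdsWithin_le_nhds).eventually
      (Iio_mem_nhds hε)).exists
    refine ⟨n, h1, fun s hs => hb ?_⟩
    obtain ⟨h3, -, -⟩ := dyadicAt_spec n h1
    rw [Metric.mem_ball, Real.dist_eq, abs_lt]
    constructor <;> linarith [hs.1, hs.2, h3.1, h3.2]

/-- A Lebesgue null set is covered by an open set of small length, which is exhausted inside `[u,
v)` by finite unions of dyadic intervals, so the bound on dyadic intervals passes to it. -/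
theorem absolutelyContinuous_of_dyadic_le {u v : ℝ} (huv : u ≤ v) {μ : Measure ℝ} {C : ℝ≥0∞}
    (hC : C ≠ ∞) (hμ : ∀ σ, μ (dyadicInterval u v σ) ≤ C * volume (dyadicInterval u v σ)) :
    μ.restrict (Ico u v) ≪ volume.restrict (Ico u v) := by
  intro s hs
  rw [Measure.restrict_apply' measurableSet_Ico] at hs ⊢
  refine le_antisymm (ENNReal.le_of_forall_pos_le_add fun ε hε _ => ?_) bot_le
  -- The `+ 1` covers the case `C = 0`.
  have hε' : (ε : ℝ≥0∞) / (C + 1) ≠ 0 := by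
    simp [ENNReal.div_eq_zero_iff, hε.ne', hC]
  obtain ⟨U, hsU, hU, hlt⟩ := Set.exists_isOpen_lt_add (μ := volume) (s ∩ Ico u v) (by simp [hs]) hε'
  rw [hs, zero_add] at hlt
  have h1 : μ (Ico u v ∩ U) ≤ C * volume U := by
    rw [← iUnion_dyadicInner hU,
      (monotone_nat_of_le_succ (dyadicInner_subset_succ huv U)).measure_iUnion]
    refine iSup_le fun n => (measure_dyadicInner_le huv U hμ n).trans ?_
    gcongr
    rintro t ⟨h1, h2⟩
    exact h2 (dyadicAt_spec n h1).1
  calc μ (s ∩ Ico u v) ≤ μ (Ico u v ∩ U) := measure_mono fun t ht => ⟨ht.2, hsU ht⟩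
    _ ≤ C * volume U := h1
    _ ≤ (C + 1) * (ε / (C + 1)) := by gcongr; exact le_self_add
    _ ≤ ε := ENNReal.mul_div_le
    _ = 0 + ε := (zero_add _).symm

/-! ### Averages over intervals -/

theorem setAverage_Ico {u v : ℝ} (huv : u ≤ v) (φ : ℝ → ℝ) :
    ⨍ t in Ico u v, φ t = (∫ t in Ico u v, φ t) / (v - u) := by
  rw [setAverage_eq, Real.volume_real_Ico_of_le huv, smul_eq_mul, inv_mul_eq_div]

theorem setAverage_Ico_half {u v : ℝ} (huv : u < v) {φ : ℝ → ℝ} (hφ : IntegrableOn φ (Ico u v)) :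
    ⨍ t in Ico u v, φ t =
      ((⨍ t in Ico u ((u + v) / 2), φ t) + ⨍ t in Ico ((u + v) / 2) v, φ t) / 2 := by
  have h1 : u ≤ (u + v) / 2 := by linarith
  have h2 : (u + v) / 2 ≤ v := by linarith
  rw [setAverage_Ico huv.le, setAverage_Ico h1, setAverage_Ico h2, ← Ico_union_half huv.le,
    setIntegral_union (Ico_disjoint_half u v) measurableSet_Ico
      (hφ.mono_set (Ico_subset_Ico_right h2)) (hφ.mono_set (Ico_subset_Ico_left h1))]
  have : v - u ≠ 0 := by linarith
  have h3 : (u + v) / 2 - u = (v - u) / 2 := by ring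
  have h4 : v - (u + v) / 2 = (v - u) / 2 := by ring
  rw [h3, h4]
  field_simp

theorem MeasureTheory.MemLp.integrableOn_Ico {u v : ℝ} {φ : ℝ → ℝ}
    (hφ : MemLp φ 2 (volume.restrict (Ico u v))) : IntegrableOn φ (Ico u v) :=
  hφ.integrable (by norm_num)

theorem sq_setAverage_Ico_le {u v : ℝ} (huv : u < v) {φ : ℝ → ℝ}
    (hφ : MemLp φ 2 (volume.restrict (Ico u v))) :
    (⨍ t in Ico u v, φ t) ^ 2 ≤ ⨍ t in Ico u v, φ t ^ 2 := by
  have hl : 0 < v - u := by linarith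
  set c := ⨍ t in Ico u v, φ t with hc
  have hc' : ∫ t in Ico u v, φ t = c * (v - u) := by
    rw [hc, setAverage_Ico huv.le, div_mul_cancel₀ _ hl.ne']
  have hi := hφ.integrableOn_Ico
  have hcst : IntegrableOn (fun _ : ℝ => c ^ 2) (Ico u v) := integrableOn_const (by simp)
  have h0 : 0 ≤ ∫ t in Ico u v, (φ t - c) ^ 2 := integral_nonneg fun _ => sq_nonneg _
  have h1 : ∫ t in Ico u v, (φ t - c) ^ 2 =
      (∫ t in Ico u v, φ t ^ 2) - 2 * c * (∫ t in Ico u v, φ t) + c ^ 2 * (v - u) := by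
    have : (fun t => (φ t - c) ^ 2) = fun t => (φ t ^ 2 - 2 * c * φ t) + c ^ 2 := by
      ext; ring
    have hs : IntegrableOn (fun t => φ t ^ 2) (Ico u v) := hφ.integrable_sq
    have hci : IntegrableOn (fun t => 2 * c * φ t) (Ico u v) := hi.const_mul _
    rw [this, integral_add (f := fun t => φ t ^ 2 - 2 * c * φ t) (Integrable.sub hs hci) hcst,
      integral_sub hs hci, integral_const_mul, setIntegral_const,
      Real.volume_real_Ico_of_le huv.le, smul_eq_mul, mul_comm (v - u)]
  rw [setAverage_Ico huv.le, le_div_iff₀ hl]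
  rw [h1, hc'] at h0
  linarith

/-- The average of `φ` over the dyadic subinterval of generation `n` containing a point. -/
noncomputable def dyadicAverage (φ : ℝ → ℝ) (n : ℕ) (u v t : ℝ) : ℝ :=
  ⨍ s in Ico (dyadicAt n u v t).1 (dyadicAt n u v t).2, φ s

theorem measurable_dyadicAverage (φ : ℝ → ℝ) (n : ℕ) (u v : ℝ) :
    Measurable (dyadicAverage φ n u v) := by
  induction n generalizing u v with
  | zero => exact measurable_const (a := ⨍ s in Ico u v, φ s)
  | succ n ih =>
    have : dyadicAverage φ (n + 1) u v = fun t => if t < (u + v) / 2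
        then dyadicAverage φ n u ((u + v) / 2) t else dyadicAverage φ n ((u + v) / 2) v t := by
      ext t
      rcases lt_or_ge t ((u + v) / 2) with h | h
      · simp [dyadicAverage, dyadicAt_left n h, h]
      · simp [dyadicAverage, dyadicAt_right n h, h.not_gt]
    rw [this]
    exact Measurable.ite measurableSet_Iio (ih _ _) (ih _ _)

theorem ae_tendsto_dyadicAverage {u v : ℝ} {φ : ℝ → ℝ} (hφ : IntegrableOn φ (Ico u v)) :
    ∀ᵐ t ∂volume.restrict (Ico u v),
      Tendsto (fun n => dyadicAverage φ n u v t) atTop (𝓝 (φ t)) := by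
  have hψ : LocallyIntegrable ((Ico u v).indicator φ) :=
    (hφ.integrable_indicator measurableSet_Ico).locallyIntegrable
  rw [ae_restrict_iff' measurableSet_Ico]
  filter_upwards [IsUnifLocDoublingMeasure.ae_tendsto_average volume hψ 1] with t hlim ht
  -- Dyadic intervals are balls about their midpoints, not about `t`. The differentiation theorem
  -- for doubling measures permits this, with ratio `1`, since `t` lies in each closed ball.
  have key := @hlim ℕ atTop
    (fun n => ((dyadicAt n u v t).1 + (dyadicAt n u v t).2) / 2)
    (fun n => ((dyadicAt n u v t).2 - (dyadicAt n u v t).1) / 2) ?_ ?_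
  · rw [indicator_of_mem ht] at key
    refine key.congr fun n => ?_
    rw [Real.closedBall_eq_Icc]
    have e1 : ∀ a b : ℝ, (a + b) / 2 - (b - a) / 2 = a := fun a b => by ring
    have e2 : ∀ a b : ℝ, (a + b) / 2 + (b - a) / 2 = b := fun a b => by ring
    rw [e1, e2, dyadicAverage, setAverage_congr Ico_ae_eq_Icc.symm]
    refine setAverage_congr_fun measurableSet_Ico (Eventually.of_forall fun s hs => ?_)
    exact indicator_of_mem ((dyadicAt_spec n ht).2.1 hs) φ
  · have := tendsto_dyadicAt ht
    rw [tendsto_nhdsWithin_iff] at this ⊢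
    refine ⟨by simpa using this.1.div_const 2, this.2.mono fun n hn => half_pos (mem_Ioi.1 hn)⟩
  · refine Eventually.of_forall fun n => ?_
    have h := (dyadicAt_spec n ht).1
    rw [Metric.mem_closedBall, Real.dist_eq, abs_le]
    constructor <;> linarith [h.1, h.2]

theorem lintegral_dyadicAverage_succ (φ : ℝ → ℝ) (μ : Measure ℝ) (n : ℕ) {u v : ℝ} (huv : u ≤ v) :
    ∫⁻ t in Ico u v, ENNReal.ofReal (dyadicAverage φ (n + 1) u v t ^ 2) ∂μ =
      ∫⁻ t in Ico u ((u + v) / 2), ENNReal.ofReal (dyadicAverage φ n u ((u + v) / 2) t ^ 2) ∂μ +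
      ∫⁻ t in Ico ((u + v) / 2) v, ENNReal.ofReal (dyadicAverage φ n ((u + v) / 2) v t ^ 2) ∂μ := by
  rw [← Ico_union_half huv, lintegral_union measurableSet_Ico (Ico_disjoint_half u v)]
  congr 1
  · refine setLIntegral_congr_fun measurableSet_Ico fun t ht => ?_
    simp only [dyadicAverage, dyadicAt_left n ht.2]
  · refine setLIntegral_congr_fun measurableSet_Ico fun t ht => ?_
    simp only [dyadicAverage, dyadicAt_right n ht.1]

/-! ### The majorants -/

/-- A family of majorants of the Bellman function, with parameter `z`. -/
noncomputable def cetMajorant (m M z x₁ x₂ x₃ : ℝ) : ℝ :=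
  m * x₂ + if x₃ = m then 0 else x₂ / (z * (1 - z * (M - m))) - x₁ ^ 2 / (z * (1 - z * (M - x₃)))

/-- This starts the Bellman induction. Lowering `x₂` to `x₁²` in the two fractions leaves `x₁² (x₃ -
m)` over a product of two factors in `(0, 1]`. -/
theorem mul_sq_le_cetMajorant {m M z x₁ x₂ x₃ : ℝ} (hm : 0 ≤ m) (hz : 0 < z)
    (hzM : z * (M - m) < 1) (hmx : m ≤ x₃) (hxM : x₃ ≤ M) (hx : x₁ ^ 2 ≤ x₂) :
    x₃ * x₁ ^ 2 ≤ cetMajorant m M z x₁ x₂ x₃ := by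
  rw [cetMajorant]
  split_ifs with h
  · subst h; nlinarith
  · have hA : 0 < 1 - z * (M - m) := by linarith
    have hB : 1 - z * (M - m) ≤ 1 - z * (M - x₃) := by nlinarith
    have hB1 : 1 - z * (M - x₃) ≤ 1 := by nlinarith
    have hB0 := hA.trans_le hB
    have h1 : x₁ ^ 2 / (z * (1 - z * (M - m))) ≤ x₂ / (z * (1 - z * (M - m))) := by gcongr
    have h2 : x₁ ^ 2 / (z * (1 - z * (M - m))) - x₁ ^ 2 / (z * (1 - z * (M - x₃))) =
        x₁ ^ 2 * (x₃ - m) / ((1 - z * (M - m)) * (1 - z * (M - x₃))) := by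
      field_simp
      ring
    have h3 : x₁ ^ 2 * (x₃ - m) ≤
        x₁ ^ 2 * (x₃ - m) / ((1 - z * (M - m)) * (1 - z * (M - x₃))) := by
      refine le_div_self (mul_nonneg (sq_nonneg _) (by linarith)) (by positivity) ?_
      nlinarith
    nlinarith

theorem cetMajorant_nonneg {m M z x₁ x₂ x₃ : ℝ} (hm : 0 ≤ m) (hz : 0 < z)
    (hzM : z * (M - m) < 1) (hmx : m ≤ x₃) (hxM : x₃ ≤ M) (hx : x₁ ^ 2 ≤ x₂) :
    0 ≤ cetMajorant m M z x₁ x₂ x₃ :=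
  (mul_nonneg (hm.trans hmx) (sq_nonneg _)).trans
    (mul_sq_le_cetMajorant hm hz hzM hmx hxM hx)

/-- The cut-off at `x₃ = m` only decreases the majorant. It is what makes part (ii) sharp: without
it the two fractions leave a positive excess there when `x₁² < x₂`. -/
theorem cetMajorant_le {m M z x₁ x₂ x₃ : ℝ} (hz : 0 < z)
    (hzM : z * (M - m) < 1) (hmx : m ≤ x₃) (hx : x₁ ^ 2 ≤ x₂) :
    cetMajorant m M z x₁ x₂ x₃ ≤
      m * x₂ + (x₂ / (z * (1 - z * (M - m))) - x₁ ^ 2 / (z * (1 - z * (M - x₃)))) := by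
  rw [cetMajorant]
  split_ifs with h
  · subst h
    have hA : 0 < 1 - z * (M - x₃) := by linarith
    have h1 : x₁ ^ 2 / (z * (1 - z * (M - x₃))) ≤ x₂ / (z * (1 - z * (M - x₃))) := by gcongr
    linarith
  · exact le_rfl

/-- If the parent has density `m`, then so do both halves and `h = 0`, and the cut-off is
consistent. Otherwise the uncut formula may be used at both halves. -/
theorem cetMajorant_step {m M z y₁ y₂ y₃ w₁ w₂ w₃ h : ℝ} (hz : 0 < z) (hzM : z * (M - m) < 1)
    (hh : 0 ≤ h) (hy : y₁ ^ 2 ≤ y₂) (hw : w₁ ^ 2 ≤ w₂) (hy₃ : m ≤ y₃) (hw₃ : m ≤ w₃) (hM : (y₃ + w₃) / 2 + h ≤ M) :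
    (cetMajorant m M z y₁ y₂ y₃ + cetMajorant m M z w₁ w₂ w₃) / 2 + ((y₁ + w₁) / 2) ^ 2 * h ≤
      cetMajorant m M z ((y₁ + w₁) / 2) ((y₂ + w₂) / 2) ((y₃ + w₃) / 2 + h) := by
  by_cases h0 : (y₃ + w₃) / 2 + h = m
  · have e1 : y₃ = m := by linarith
    have e2 : w₃ = m := by linarith
    have e3 : h = 0 := by linarith
    simp [cetMajorant, e1, e2, e3]
    linarith
  refine le_trans (add_le_add_left (div_le_div_of_nonneg_right (add_le_add
    (cetMajorant_le hz hzM hy₃ hy) (cetMajorant_le hz hzM hw₃ hw)) zero_le_two) _) ?_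
  rw [cetMajorant, if_neg h0]
  have hp : ∀ t, m ≤ t → 0 < 1 - z * (M - t) := fun t ht => by nlinarith
  set A := 1 - z * (M - y₃) with hA
  set B := 1 - z * (M - w₃) with hB
  set C := 1 - z * (M - ((y₃ + w₃) / 2 + h)) with hC
  have hA0 : 0 < A := hp _ hy₃
  have hB0 : 0 < B := hp _ hw₃
  have hC1 : C ≤ 1 := by nlinarith
  have hS : (A + B) / 2 = C - z * h := by rw [hA, hB, hC]; ring
  have hS0 : 0 < (A + B) / 2 := by linarith
  have hzh : 0 ≤ z * h := by positivity
  have hC0 : 0 < C := by linarith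
  set x := (y₁ + w₁) / 2 with hx
  -- Joint convexity of square over linear; the defect is an explicit square.
  have h1 : x ^ 2 / (z * ((A + B) / 2)) ≤ (y₁ ^ 2 / (z * A) + w₁ ^ 2 / (z * B)) / 2 := by
    have : (y₁ ^ 2 / (z * A) + w₁ ^ 2 / (z * B)) / 2 - x ^ 2 / (z * ((A + B) / 2)) =
        (B * y₁ - A * w₁) ^ 2 / (2 * z * A * B * (A + B)) := by
      rw [hx]
      have : A + B ≠ 0 := by linarith
      field_simp
      ring
    have h2 : 0 ≤ (B * y₁ - A * w₁) ^ 2 / (2 * z * A * B * (A + B)) := by positivity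
    linarith
  -- The gain from raising `x₃` by `h`: the denominators lie in `(0, 1]`, so it is at least `x² h`.
  have h2 : x ^ 2 * h ≤ x ^ 2 / (z * ((A + B) / 2)) - x ^ 2 / (z * C) := by
    have : x ^ 2 / (z * ((A + B) / 2)) - x ^ 2 / (z * C) = x ^ 2 * h / (((A + B) / 2) * C) := by
      have e : z * h = C - (A + B) / 2 := by linarith
      field_simp
      linear_combination (-2 * x ^ 2) * e
    rw [this]
    refine le_div_self (by positivity) (by positivity) ?_
    nlinarith
  have h3 : (y₂ + w₂) / 2 / (z * (1 - z * (M - m))) =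
      (y₂ / (z * (1 - z * (M - m))) + w₂ / (z * (1 - z * (M - m)))) / 2 := by ring
  rw [h3]
  linarith

/-! ### The upper bound -/

/-- The mass `cetMass` of the whole interval per unit length, as a real number. -/
noncomputable def cetDensity (u v : ℝ) (μ : Measure ℝ) (α : List Bool → ℝ≥0) : ℝ :=
  (cetMass u v μ α []).toReal / (v - u)

/-- The two-sided mass bounds required of an admissible triple. -/
def CetBounded (u v m M : ℝ) (μ : Measure ℝ) (α : List Bool → ℝ≥0) : Prop :=
  ∀ σ, ENNReal.ofReal m * volume (dyadicInterval u v σ) ≤ cetMass u v μ α σ ∧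
    cetMass u v μ α σ ≤ ENNReal.ofReal M * volume (dyadicInterval u v σ)

section

variable {u v m M : ℝ} {μ : Measure ℝ} {α : List Bool → ℝ≥0}

theorem CetBounded.left (h : CetBounded u v m M μ α) :
    CetBounded u ((u + v) / 2) m M μ (fun σ => α (false :: σ)) := fun σ => h (false :: σ)

theorem CetBounded.right (h : CetBounded u v m M μ α) :
    CetBounded ((u + v) / 2) v m M μ (fun σ => α (true :: σ)) := fun σ => h (true :: σ)

theorem CetBounded.mass_ne_top (h : CetBounded u v m M μ α) : cetMass u v μ α [] ≠ ∞ := by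
  refine ne_top_of_le_ne_top ?_ (h []).2
  rw [dyadicInterval_nil, Real.volume_Ico]
  exact ENNReal.mul_ne_top ENNReal.ofReal_ne_top ENNReal.ofReal_ne_top

theorem CetBounded.le_density (h : CetBounded u v m M μ α) (huv : u < v) (hm : 0 ≤ m) :
    m ≤ cetDensity u v μ α := by
  have h1 := ENNReal.toReal_mono h.mass_ne_top (h []).1
  rw [dyadicInterval_nil, Real.volume_Ico, ENNReal.toReal_mul, ENNReal.toReal_ofReal hm,
    ENNReal.toReal_ofReal (by linarith)] at h1
  rwa [cetDensity, le_div_iff₀ (by linarith)]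

theorem CetBounded.density_le (h : CetBounded u v m M μ α) (huv : u < v) (hM : 0 ≤ M) :
    cetDensity u v μ α ≤ M := by
  have h1 := ENNReal.toReal_mono (by
    rw [dyadicInterval_nil, Real.volume_Ico]
    exact ENNReal.mul_ne_top ENNReal.ofReal_ne_top ENNReal.ofReal_ne_top) (h []).2
  rw [dyadicInterval_nil, Real.volume_Ico, ENNReal.toReal_mul, ENNReal.toReal_ofReal hM,
    ENNReal.toReal_ofReal (by linarith)] at h1
  rwa [cetDensity, div_le_iff₀ (by linarith)]

theorem CetBounded.density_eq (h : CetBounded u v m M μ α) (huv : u < v) :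
    cetDensity u v μ α =
      (cetDensity u ((u + v) / 2) μ (fun σ => α (false :: σ)) +
        cetDensity ((u + v) / 2) v μ (fun σ => α (true :: σ))) / 2 + α [] / (v - u) := by
  have e := cetMass_nil huv.le μ α
  rw [cetMass_false, cetMass_true] at e
  have e' := congrArg ENNReal.toReal e
  rw [ENNReal.toReal_add ENNReal.coe_ne_top
      (ENNReal.add_ne_top.2 ⟨h.left.mass_ne_top, h.right.mass_ne_top⟩),
    ENNReal.toReal_add h.left.mass_ne_top h.right.mass_ne_top, ENNReal.coe_toReal] at e'
  rw [cetDensity, e', cetDensity, cetDensity]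
  have : v - u ≠ 0 := by linarith
  have h3 : (u + v) / 2 - u = (v - u) / 2 := by ring
  have h4 : v - (u + v) / 2 = (v - u) / 2 := by ring
  rw [h3, h4]
  field_simp
  ring

/-- Bellman induction down to generation `n`. -/
theorem treeSum_add_lintegral_le (hm : 0 ≤ m) (hmM : m ≤ M) {z : ℝ} (hz : 0 < z)
    (hzM : z * (M - m) < 1) {φ : ℝ → ℝ} (n : ℕ) (huv : u < v)
    (hφ : MemLp φ 2 (volume.restrict (Ico u v))) (h : CetBounded u v m M μ α) :
    treeSum n (fun σ => ENNReal.ofReal ((⨍ t in dyadicInterval u v σ, φ t) ^ 2) * (α σ : ℝ≥0∞)) +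
      ∫⁻ t in Ico u v, ENNReal.ofReal (dyadicAverage φ n u v t ^ 2) ∂μ ≤
    ENNReal.ofReal ((v - u) * cetMajorant m M z (⨍ t in Ico u v, φ t) (⨍ t in Ico u v, φ t ^ 2)
      (cetDensity u v μ α)) := by
  have hM : 0 ≤ M := hm.trans hmM
  induction n generalizing u v α with
  | zero =>
    have hl : 0 < v - u := by linarith
    have e : ∀ t, dyadicAverage φ 0 u v t = ⨍ t in Ico u v, φ t := fun t => rfl
    simp only [treeSum, zero_add, e, lintegral_const, Measure.restrict_apply MeasurableSet.univ,
      univ_inter]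
    have h1 : μ (Ico u v) ≤ ENNReal.ofReal ((v - u) * cetDensity u v μ α) := by
      rw [cetDensity, mul_div_cancel₀ _ hl.ne', ENNReal.ofReal_toReal h.mass_ne_top, cetMass]
      exact le_self_add
    refine (mul_le_mul_right h1 _).trans ?_
    rw [← ENNReal.ofReal_mul (sq_nonneg _)]
    refine ENNReal.ofReal_le_ofReal ?_
    have := mul_sq_le_cetMajorant hm hz hzM (h.le_density huv hm) (h.density_le huv hM)
      (sq_setAverage_Ico_le huv hφ)
    nlinarith
  | succ n ih =>
    have hl : 0 < v - u := by linarith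
    have h1 : u < (u + v) / 2 := by linarith
    have h2 : (u + v) / 2 < v := by linarith
    have hφ1 : MemLp φ 2 (volume.restrict (Ico u ((u + v) / 2))) :=
      hφ.mono_measure (Measure.restrict_mono (Ico_subset_Ico_right h2.le) le_rfl)
    have hφ2 : MemLp φ 2 (volume.restrict (Ico ((u + v) / 2) v)) :=
      hφ.mono_measure (Measure.restrict_mono (Ico_subset_Ico_left h1.le) le_rfl)
    have i1 := ih h1 hφ1 h.left
    have i2 := ih h2 hφ2 h.right
    -- Nonnegativity is needed to split `ENNReal.ofReal` over the sum of the two halves.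
    have n1 := cetMajorant_nonneg hm hz hzM (h.left.le_density h1 hm) (h.left.density_le h1 hM)
      (sq_setAverage_Ico_le h1 hφ1)
    have n2 := cetMajorant_nonneg hm hz hzM (h.right.le_density h2 hm) (h.right.density_le h2 hM)
      (sq_setAverage_Ico_le h2 hφ2)
    have st := cetMajorant_step (M := M) (h := α [] / (v - u)) hz hzM
      (div_nonneg (α []).coe_nonneg hl.le)
      (sq_setAverage_Ico_le h1 hφ1) (sq_setAverage_Ico_le h2 hφ2)
      (h.left.le_density h1 hm) (h.right.le_density h2 hm)
      (by rw [← h.density_eq huv]; exact h.density_le huv hM)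
    rw [← h.density_eq huv, ← setAverage_Ico_half huv hφ.integrableOn_Ico,
      ← setAverage_Ico_half huv (φ := fun t => φ t ^ 2) hφ.integrable_sq] at st
    rw [lintegral_dyadicAverage_succ φ μ n huv.le, treeSum]
    have h3 : (u + v) / 2 - u = (v - u) / 2 := by ring
    have h4 : v - (u + v) / 2 = (v - u) / 2 := by ring
    rw [h3] at i1
    rw [h4] at i2
    have i0 : ENNReal.ofReal ((⨍ t in Ico u v, φ t) ^ 2) * (α [] : ℝ≥0∞) =
        ENNReal.ofReal ((⨍ t in Ico u v, φ t) ^ 2 * α []) := by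
      rw [ENNReal.ofReal_mul (sq_nonneg _), ENNReal.ofReal_coe_nnreal]
    have st' := mul_le_mul_of_nonneg_left st hl.le
    have e0 : (v - u) * ((⨍ t in Ico u v, φ t) ^ 2 * (α [] / (v - u))) =
        (⨍ t in Ico u v, φ t) ^ 2 * α [] := by field_simp
    rw [mul_add, e0] at st'
    refine le_trans ?_ (ENNReal.ofReal_le_ofReal st')
    have e1 : ∀ a b : ℝ, (v - u) * ((a + b) / 2) = (v - u) / 2 * a + (v - u) / 2 * b :=
      fun a b => by ring
    rw [ENNReal.ofReal_add (mul_nonneg hl.le (by linarith)) (by positivity), e1,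
      ENNReal.ofReal_add (by positivity) (by positivity), ← i0, dyadicInterval_nil]
    refine le_trans (le_of_eq ?_) (add_le_add_left (add_le_add i1 i2) _)
    simp only [dyadicInterval_false, dyadicInterval_true]
    ring

theorem CetBounded.absolutelyContinuous (h : CetBounded u v m M μ α) (huv : u ≤ v) :
    μ.restrict (Ico u v) ≪ volume.restrict (Ico u v) :=
  absolutelyContinuous_of_dyadic_le huv (C := ENNReal.ofReal M) ENNReal.ofReal_ne_top fun σ =>
    le_trans (by rw [cetMass]; exact le_self_add) (h σ).2

theorem cetFunctional_le (hm : 0 ≤ m) (hmM : m ≤ M) {z : ℝ} (hz : 0 < z)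
    (hzM : z * (M - m) < 1) {φ : ℝ → ℝ} (huv : u < v)
    (hφ : MemLp φ 2 (volume.restrict (Ico u v))) (h : CetBounded u v m M μ α) :
    cetFunctional u v φ μ α ≤
    ENNReal.ofReal (cetMajorant m M z (⨍ t in Ico u v, φ t) (⨍ t in Ico u v, φ t ^ 2)
      (cetDensity u v μ α)) := by
  have hl : 0 < v - u := by linarith
  rw [cetFunctional, Real.volume_Ico]
  refine ENNReal.div_le_of_le_mul ?_
  rw [← ENNReal.ofReal_mul' hl.le, mul_comm _ (v - u)]
  have key := fun n => treeSum_add_lintegral_le hm hmM hz hzM n huv hφ h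
  set B := ENNReal.ofReal ((v - u) * cetMajorant m M z (⨍ t in Ico u v, φ t)
    (⨍ t in Ico u v, φ t ^ 2) (cetDensity u v μ α))
  set F := fun σ => ENNReal.ofReal ((⨍ t in dyadicInterval u v σ, φ t) ^ 2) * (α σ : ℝ≥0∞)
  -- The dyadic averages converge to `φ` Lebesgue-a.e., hence `μ`-a.e. by absolute continuity.
  have hfatou : ∫⁻ t in Ico u v, ENNReal.ofReal (φ t ^ 2) ∂μ ≤
      liminf (fun n => ∫⁻ t in Ico u v, ENNReal.ofReal (dyadicAverage φ n u v t ^ 2) ∂μ) atTop := by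
    have hmeas : ∀ n, Measurable fun t => ENNReal.ofReal (dyadicAverage φ n u v t ^ 2) :=
      fun n => ((measurable_dyadicAverage φ n u v).pow_const 2).ennreal_ofReal
    refine le_trans (lintegral_mono_ae ?_) (lintegral_liminf_le hmeas)
    filter_upwards [(h.absolutelyContinuous huv.le).ae_le
      (ae_tendsto_dyadicAverage hφ.integrableOn_Ico)] with t ht
    exact (ENNReal.tendsto_ofReal (ht.pow 2)).liminf_eq.ge
  refine le_trans (add_le_add hfatou (tsum_le_iSup_treeSum F)) ?_
  rw [ENNReal.add_iSup]
  refine iSup_le fun k => ?_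
  rw [liminf_eq_iSup_iInf_of_nat, ENNReal.iSup_add]
  refine iSup_le fun n => ?_
  rw [add_comm]
  -- The truncation depth `k` and the tail index `n` are both compared with generation `max k n`.
  exact (add_le_add (treeSum_mono F (le_max_left k n))
    (iInf₂_le (max k n) (le_max_right k n))).trans (key (max k n))

theorem cetBellman_le {x₁ x₂ x₃ : ℝ} (hm : 0 ≤ m) (hmM : m ≤ M) {z : ℝ} (hz : 0 < z)
    (hzM : z * (M - m) < 1) (huv : u < v) (hx₃ : 0 ≤ x₃) :
    cetBellman u v x₁ x₂ x₃ m M ≤ ENNReal.ofReal (cetMajorant m M z x₁ x₂ x₃) := by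
  refine sSup_le ?_
  rintro y ⟨φ, μ, α, h, rfl⟩
  have hb : CetBounded u v m M μ α := fun σ => ⟨h.lower σ, h.upper σ⟩
  have hd : cetDensity u v μ α = x₃ := by
    have := congrArg ENNReal.toReal h.mass
    rwa [ENNReal.toReal_div, Real.volume_Ico, ENNReal.toReal_ofReal (by linarith),
      ENNReal.toReal_ofReal hx₃] at this
  have := cetFunctional_le hm hmM hz hzM huv h.memLp hb
  rwa [h.average, h.average_sq, hd] at this

end

/-! ### Admissible triples -/

/-- On every interval some admissible triple with the data `x` attains at least `c`. -/
def CetReach (m M x₁ x₂ x₃ c : ℝ) : Prop :=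
  ∀ u v : ℝ, u < v → ∃ (φ : ℝ → ℝ) (μ : Measure ℝ) (α : List Bool → ℝ≥0),
    CetAdmissible u v m M x₁ x₂ x₃ φ μ α ∧ ENNReal.ofReal c ≤ cetFunctional u v φ μ α

theorem volume_Ico_ne_zero {u v : ℝ} (huv : u < v) : volume (Ico u v) ≠ 0 := by
  simp [huv]

theorem volume_Ico_ne_top {u v : ℝ} : volume (Ico u v) ≠ ∞ := by
  simp

theorem CetReach.mono {m M x₁ x₂ x₃ c d : ℝ} (h : CetReach m M x₁ x₂ x₃ c) (hd : d ≤ c) :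
    CetReach m M x₁ x₂ x₃ d := fun u v huv =>
  let ⟨φ, μ, α, h1, h2⟩ := h u v huv
  ⟨φ, μ, α, h1, (ENNReal.ofReal_le_ofReal hd).trans h2⟩

theorem cetReach_const {m M x₃ : ℝ} (hmx : m ≤ x₃) (hxM : x₃ ≤ M) (x₁ : ℝ) :
    CetReach m M x₁ (x₁ ^ 2) x₃ (x₃ * x₁ ^ 2) := by
  intro u v huv
  have hvol : ∀ x : ℝ, ⨍ _ in Ico u v, x = x := fun x =>
    setAverage_const (volume_Ico_ne_zero huv) volume_Ico_ne_top x
  have hmass : ∀ σ, cetMass u v (ENNReal.ofReal x₃ • volume.restrict (Ico u v)) 0 σ =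
      ENNReal.ofReal x₃ * volume (dyadicInterval u v σ) := fun σ => by
    simp [cetMass, Measure.restrict_apply (measurableSet_dyadicInterval u v σ),
      inter_eq_left.2 (dyadicInterval_subset huv.le σ)]
  refine ⟨fun _ => x₁, ENNReal.ofReal x₃ • volume.restrict (Ico u v), 0,
    ⟨memLp_const _, fun t => ?_, ?_, hvol _, hvol _, ?_, fun σ => ?_, fun σ => ?_⟩, ?_⟩
  · simp
  · simp [Measure.restrict_apply]
  · rw [hmass, dyadicInterval_nil,
      ENNReal.mul_div_cancel_right (volume_Ico_ne_zero huv) volume_Ico_ne_top]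
  · rw [hmass]; gcongr
  · rw [hmass]; gcongr
  · rw [cetFunctional, ENNReal.le_div_iff_mul_le (.inl (volume_Ico_ne_zero huv))
      (.inl volume_Ico_ne_top), ENNReal.ofReal_mul' (sq_nonneg _)]
    simp
    rw [mul_comm (ENNReal.ofReal x₃), mul_assoc]

theorem CetReach.smul {m M x₁ x₂ x₃ c : ℝ} (h : CetReach m M x₁ x₂ x₃ c) (l : ℝ) :
    CetReach m M (l * x₁) (l ^ 2 * x₂) x₃ (l ^ 2 * c) := by
  intro u v huv
  obtain ⟨φ, μ, α, h1, h2⟩ := h u v huv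
  have hav : ∀ s : Set ℝ, ∀ (k : ℝ) (ψ : ℝ → ℝ), ⨍ t in s, k * ψ t = k * ⨍ t in s, ψ t := by
    intro s k ψ
    rw [setAverage_eq, setAverage_eq, integral_const_mul, smul_eq_mul, smul_eq_mul]
    ring
  refine ⟨fun t => l * φ t, μ, α, ⟨h1.memLp.const_mul l, h1.noAtoms, h1.supported, ?_, ?_,
    h1.mass, h1.lower, h1.upper⟩, ?_⟩
  · rw [hav, h1.average]
  · simp only [mul_pow, hav, h1.average_sq]
  · have : cetFunctional u v (fun t => l * φ t) μ α =
        ENNReal.ofReal (l ^ 2) * cetFunctional u v φ μ α := by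
      simp only [cetFunctional, hav, mul_pow, ENNReal.ofReal_mul (sq_nonneg l), mul_assoc,
        ENNReal.tsum_mul_left]
      rw [lintegral_const_mul' _ _ ENNReal.ofReal_ne_top, ← mul_add, mul_div_assoc]
    rw [this, ENNReal.ofReal_mul (sq_nonneg l)]
    gcongr

/-! ### Concatenation -/

/-- The family on `D(I)` with value `a` at `I` that extends families on the two halves. -/
def consFamily (a : ℝ≥0) (β γ : List Bool → ℝ≥0) : List Bool → ℝ≥0
  | [] => a
  | false :: σ => β σ
  | true :: σ => γ σ

/-- The numerator of `cetFunctional`. -/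
noncomputable def cetTotal (u v : ℝ) (φ : ℝ → ℝ) (μ : Measure ℝ) (α : List Bool → ℝ≥0) : ℝ≥0∞ :=
  (∫⁻ t in Ico u v, ENNReal.ofReal (φ t ^ 2) ∂μ) +
    ∑' σ : List Bool, ENNReal.ofReal ((⨍ t in dyadicInterval u v σ, φ t) ^ 2) * (α σ : ℝ≥0∞)

theorem CetAdmissible.mass_eq {u v m M x₁ x₂ x₃ : ℝ} {φ : ℝ → ℝ} {μ : Measure ℝ}
    {α : List Bool → ℝ≥0} (h : CetAdmissible u v m M x₁ x₂ x₃ φ μ α) (huv : u < v) :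
    cetMass u v μ α [] = ENNReal.ofReal x₃ * ENNReal.ofReal (v - u) := by
  rw [← Real.volume_Ico, ← h.mass,
    ENNReal.div_mul_cancel (volume_Ico_ne_zero huv) volume_Ico_ne_top]

section concat

variable {u v m M : ℝ} {φ ψ : ℝ → ℝ} {μ ν : Measure ℝ} {β γ : List Bool → ℝ≥0}

theorem measure_add_left {c : ℝ} (hν : ν (Ico c v)ᶜ = 0) {s : Set ℝ} (hs : s ⊆ Ico u c) :
    (μ + ν) s = μ s := by
  have : ν s = 0 := measure_mono_null (show s ⊆ (Ico c v)ᶜ from fun t ht hc => (hs ht).2.not_ge hc.1) hν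
  simp [this]

theorem measure_add_right {c : ℝ} (hμ : μ (Ico u c)ᶜ = 0) {s : Set ℝ} (hs : s ⊆ Ico c v) :
    (μ + ν) s = ν s := by
  have : μ s = 0 := measure_mono_null (show s ⊆ (Ico u c)ᶜ from fun t ht hc => (hs ht).1.not_gt hc.2) hμ
  simp [this]

theorem restrict_add_left {c : ℝ} (hν : ν (Ico c v)ᶜ = 0) :
    (μ + ν).restrict (Ico u c) = μ.restrict (Ico u c) := by
  ext s hs
  rw [Measure.restrict_apply hs, Measure.restrict_apply hs,
    measure_add_left hν inter_subset_right]

theorem restrict_add_right {c : ℝ} (hμ : μ (Ico u c)ᶜ = 0) :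
    (μ + ν).restrict (Ico c v) = ν.restrict (Ico c v) := by
  ext s hs
  rw [Measure.restrict_apply hs, Measure.restrict_apply hs,
    measure_add_right hμ inter_subset_right]

theorem cetTotal_concat (huv : u < v) (hμ : μ (Ico u ((u + v) / 2))ᶜ = 0)
    (hν : ν (Ico ((u + v) / 2) v)ᶜ = 0) (a : ℝ≥0) :
    cetTotal u v (fun t => if t < (u + v) / 2 then φ t else ψ t) (μ + ν) (consFamily a β γ) =
      ENNReal.ofReal ((⨍ t in Ico u v, if t < (u + v) / 2 then φ t else ψ t) ^ 2) * a +
      (cetTotal u ((u + v) / 2) φ μ β + cetTotal ((u + v) / 2) v ψ ν γ) := by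
  have h1 : u ≤ (u + v) / 2 := by linarith
  have h2 : (u + v) / 2 ≤ v := by linarith
  have e1 : ∀ σ, ⨍ t in dyadicInterval u ((u + v) / 2) σ, (if t < (u + v) / 2 then φ t else ψ t) =
      ⨍ t in dyadicInterval u ((u + v) / 2) σ, φ t := fun σ =>
    setAverage_congr_fun (measurableSet_dyadicInterval _ _ σ)
      (Eventually.of_forall fun t ht => if_pos (dyadicInterval_subset h1 σ ht).2)
  have e2 : ∀ σ, ⨍ t in dyadicInterval ((u + v) / 2) v σ, (if t < (u + v) / 2 then φ t else ψ t) =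
      ⨍ t in dyadicInterval ((u + v) / 2) v σ, ψ t := fun σ =>
    setAverage_congr_fun (measurableSet_dyadicInterval _ _ σ)
      (Eventually.of_forall fun t ht => if_neg (dyadicInterval_subset h2 σ ht).1.not_gt)
  have e3 : ∫⁻ t in Ico u ((u + v) / 2),
      ENNReal.ofReal ((if t < (u + v) / 2 then φ t else ψ t) ^ 2) ∂(μ + ν) =
      ∫⁻ t in Ico u ((u + v) / 2), ENNReal.ofReal (φ t ^ 2) ∂μ := by
    rw [restrict_add_left hν]
    exact setLIntegral_congr_fun measurableSet_Ico fun t ht => by simp only [if_pos ht.2]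
  have e4 : ∫⁻ t in Ico ((u + v) / 2) v,
      ENNReal.ofReal ((if t < (u + v) / 2 then φ t else ψ t) ^ 2) ∂(μ + ν) =
      ∫⁻ t in Ico ((u + v) / 2) v, ENNReal.ofReal (ψ t ^ 2) ∂ν := by
    rw [restrict_add_right hμ]
    exact setLIntegral_congr_fun measurableSet_Ico fun t ht => by simp only [if_neg ht.1.not_gt]
  simp only [cetTotal]
  rw [tsum_list_bool]
  simp only [dyadicInterval_nil, dyadicInterval_false, dyadicInterval_true, consFamily, e1, e2]
  nth_rw 1 [← Ico_union_half huv.le]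
  rw [lintegral_union measurableSet_Ico (Ico_disjoint_half u v), e3, e4]
  ring

/-- Every proper dyadic subinterval lies in one half, where the other measure vanishes, so only the
mass bounds at `I` itself are new. -/
theorem CetAdmissible.concat {y₁ y₂ y₃ w₁ w₂ w₃ h : ℝ} (huv : u < v)
    (hy : CetAdmissible u ((u + v) / 2) m M y₁ y₂ y₃ φ μ β)
    (hw : CetAdmissible ((u + v) / 2) v m M w₁ w₂ w₃ ψ ν γ)
    (hm : 0 ≤ m) (hy₃ : m ≤ y₃) (hw₃ : m ≤ w₃) (hh : 0 ≤ h) (hM : (y₃ + w₃) / 2 + h ≤ M) :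
    CetAdmissible u v m M ((y₁ + w₁) / 2) ((y₂ + w₂) / 2) ((y₃ + w₃) / 2 + h)
      (fun t => if t < (u + v) / 2 then φ t else ψ t) (μ + ν)
      (consFamily (h * (v - u)).toNNReal β γ) := by
  have h1 : u < (u + v) / 2 := by linarith
  have h2 : (u + v) / 2 < v := by linarith
  have hl : 0 < v - u := by linarith
  have h3 : (u + v) / 2 - u = (v - u) / 2 := by ring
  have h4 : v - (u + v) / 2 = (v - u) / 2 := by ring
  have mf : ∀ σ, cetMass u v (μ + ν) (consFamily (h * (v - u)).toNNReal β γ) (false :: σ) =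
      cetMass u ((u + v) / 2) μ β σ := fun σ => by
    rw [cetMass_false, cetMass, measure_add_left hw.supported (dyadicInterval_subset h1.le σ)]
    rfl
  have mt : ∀ σ, cetMass u v (μ + ν) (consFamily (h * (v - u)).toNNReal β γ) (true :: σ) =
      cetMass ((u + v) / 2) v ν γ σ := fun σ => by
    rw [cetMass_true, cetMass, measure_add_right hy.supported (dyadicInterval_subset h2.le σ)]
    rfl
  have m0 : cetMass u v (μ + ν) (consFamily (h * (v - u)).toNNReal β γ) [] =
      ENNReal.ofReal ((y₃ + w₃) / 2 + h) * volume (Ico u v) := by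
    rw [cetMass_nil huv.le, mf, mt, hy.mass_eq h1, hw.mass_eq h2, h3, h4, Real.volume_Ico,
      ← ENNReal.ofReal_mul (by linarith), ← ENNReal.ofReal_mul (by linarith),
      ← ENNReal.ofReal_mul (by linarith), ← ENNReal.ofReal_add (by nlinarith) (by nlinarith),
      consFamily]
    change ENNReal.ofReal _ + _ = _
    rw [← ENNReal.ofReal_add (by positivity) (by nlinarith)]
    congr 1
    ring
  have hφ : MemLp (fun t => if t < (u + v) / 2 then φ t else ψ t) 2
      (volume.restrict (Ico u v)) := by
    refine MemLp.piecewise (s := Iio ((u + v) / 2)) measurableSet_Iio ?_ ?_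
    · rw [Measure.restrict_restrict measurableSet_Iio]
      have : Iio ((u + v) / 2) ∩ Ico u v = Ico u ((u + v) / 2) := by
        ext t
        simp only [mem_inter_iff, mem_Iio, mem_Ico]
        exact ⟨fun ⟨p, q, _⟩ => ⟨q, p⟩, fun ⟨q, p⟩ => ⟨p, q, p.trans h2⟩⟩
      rw [this]
      exact hy.memLp
    · rw [Measure.restrict_restrict measurableSet_Iio.compl]
      have : (Iio ((u + v) / 2))ᶜ ∩ Ico u v = Ico ((u + v) / 2) v := by
        ext t
        simp only [mem_inter_iff, mem_compl_iff, mem_Iio, not_lt, mem_Ico]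
        exact ⟨fun ⟨p, _, q⟩ => ⟨p, q⟩, fun ⟨p, q⟩ => ⟨p, h1.le.trans p, q⟩⟩
      rw [this]
      exact hw.memLp
  have a1 : ∀ f g k : ℝ → ℝ, (∀ t, k t = if t < (u + v) / 2 then f t else g t) →
      IntegrableOn k (Ico u v) → ⨍ t in Ico u v, k t =
      ((⨍ t in Ico u ((u + v) / 2), f t) + ⨍ t in Ico ((u + v) / 2) v, g t) / 2 := by
    intro f g k hk hi
    rw [setAverage_Ico_half huv hi]
    congr 2
    · exact setAverage_congr_fun measurableSet_Ico
        (Eventually.of_forall fun t ht => by rw [hk, if_pos ht.2])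
    · exact setAverage_congr_fun measurableSet_Ico
        (Eventually.of_forall fun t ht => by rw [hk, if_neg ht.1.not_gt])
  refine ⟨hφ, fun t => ?_, ?_, ?_, ?_, ?_, ?_, ?_⟩
  · simp [hy.noAtoms, hw.noAtoms]
  · rw [Measure.add_apply, measure_mono_null (compl_subset_compl.2 (Ico_subset_Ico_right h2.le))
      hy.supported, measure_mono_null (compl_subset_compl.2 (Ico_subset_Ico_left h1.le))
      hw.supported, add_zero]
  · rw [a1 φ ψ _ (fun _ => rfl) hφ.integrableOn_Ico, hy.average, hw.average]
  · rw [a1 (fun t => φ t ^ 2) (fun t => ψ t ^ 2) _ (fun t => by split_ifs <;> rfl)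
      hφ.integrable_sq, hy.average_sq, hw.average_sq]
  · rw [m0, ENNReal.mul_div_cancel_right (volume_Ico_ne_zero huv) volume_Ico_ne_top]
  · rintro (_ | ⟨_ | _, σ⟩)
    · rw [m0, dyadicInterval_nil]
      gcongr
      linarith
    · rw [mf]; exact hy.lower σ
    · rw [mt]; exact hw.lower σ
  · rintro (_ | ⟨_ | _, σ⟩)
    · rw [m0, dyadicInterval_nil]
      gcongr
    · rw [mf]; exact hy.upper σ
    · rw [mt]; exact hw.upper σ

end concat

/-- The constructive counterpart of `cetMajorant_step`: the same inequality, for attainable values.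
-/
theorem CetReach.concat {m M y₁ y₂ y₃ w₁ w₂ w₃ h c d : ℝ} (hy : CetReach m M y₁ y₂ y₃ c)
    (hw : CetReach m M w₁ w₂ w₃ d) (hm : 0 ≤ m) (hy₃ : m ≤ y₃) (hw₃ : m ≤ w₃) (hh : 0 ≤ h)
    (hM : (y₃ + w₃) / 2 + h ≤ M) :
    CetReach m M ((y₁ + w₁) / 2) ((y₂ + w₂) / 2) ((y₃ + w₃) / 2 + h)
      ((c + d) / 2 + ((y₁ + w₁) / 2) ^ 2 * h) := by
  intro u v huv
  have hl : 0 < v - u := by linarith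
  have h1 : u < (u + v) / 2 := by linarith
  have h2 : (u + v) / 2 < v := by linarith
  have h3 : (u + v) / 2 - u = (v - u) / 2 := by ring
  have h4 : v - (u + v) / 2 = (v - u) / 2 := by ring
  obtain ⟨φ, μ, β, ay, fy⟩ := hy _ _ h1
  obtain ⟨ψ, ν, γ, aw, fw⟩ := hw _ _ h2
  have ha := ay.concat huv aw hm hy₃ hw₃ hh hM
  refine ⟨_, _, _, ha, ?_⟩
  change _ ≤ cetTotal _ _ _ _ _ / _
  change _ ≤ cetTotal _ _ _ _ _ / _ at fy
  change _ ≤ cetTotal _ _ _ _ _ / _ at fw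
  rw [ENNReal.le_div_iff_mul_le (.inl (volume_Ico_ne_zero ‹_›)) (.inl volume_Ico_ne_top),
    Real.volume_Ico, ← ENNReal.ofReal_mul' (by linarith)] at fy fw ⊢
  rw [h3] at fy
  rw [h4] at fw
  rw [cetTotal_concat huv ay.supported aw.supported, ha.average]
  have e : ((c + d) / 2 + ((y₁ + w₁) / 2) ^ 2 * h) * (v - u) =
      ((y₁ + w₁) / 2) ^ 2 * (h * (v - u)) + (c * ((v - u) / 2) + d * ((v - u) / 2)) := by ring
  rw [e]
  refine ENNReal.ofReal_add_le.trans (add_le_add ?_ (ENNReal.ofReal_add_le.trans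
    (add_le_add fy fw)))
  rw [ENNReal.ofReal_mul (sq_nonneg _)]
  rfl

/-! ### The lower bound -/

/-- On every interval the Bellman function at `x` is at least `c`. -/
def CetBelow (m M x₁ x₂ x₃ c : ℝ) : Prop := ∀ d < c, CetReach m M x₁ x₂ x₃ d

section

variable {m M x₁ x₂ x₃ y₁ y₂ y₃ w₁ w₂ w₃ c d : ℝ}

theorem CetReach.below (h : CetReach m M x₁ x₂ x₃ c) : CetBelow m M x₁ x₂ x₃ c :=
  fun _ hd => h.mono hd.le

theorem CetBelow.mono (h : CetBelow m M x₁ x₂ x₃ c) (hd : d ≤ c) : CetBelow m M x₁ x₂ x₃ d :=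
  fun e he => h e (he.trans_le hd)

theorem CetBelow.of_tendsto {f : ℕ → ℝ} (hf : Tendsto f atTop (𝓝 c))
    (h : ∀ n, CetBelow m M x₁ x₂ x₃ (f n)) : CetBelow m M x₁ x₂ x₃ c := fun d hd =>
  let ⟨n, hn⟩ := (hf.eventually (lt_mem_nhds hd)).exists
  h n d hn

theorem CetBelow.le_cetBellman (h : CetBelow m M x₁ x₂ x₃ c) {u v : ℝ} (huv : u < v) :
    ENNReal.ofReal c ≤ cetBellman u v x₁ x₂ x₃ m M := by
  have h1 : ∀ n : ℕ, ENNReal.ofReal (c - 1 / ((n : ℝ) + 1)) ≤ cetBellman u v x₁ x₂ x₃ m M := by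
    intro n
    obtain ⟨φ, μ, α, ha, hle⟩ := h (c - 1 / ((n : ℝ) + 1))
      (sub_lt_self _ Nat.one_div_pos_of_nat) u v huv
    exact hle.trans (le_sSup ⟨φ, μ, α, ha, rfl⟩)
  refine le_of_tendsto' (x := atTop) (ENNReal.tendsto_ofReal ?_) h1
  simpa using tendsto_one_div_add_atTop_nhds_zero_nat.const_sub c

theorem CetBelow.smul (h : CetBelow m M x₁ x₂ x₃ c) {l : ℝ} (hl : 0 < l) :
    CetBelow m M (l * x₁) (l ^ 2 * x₂) x₃ (l ^ 2 * c) := by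
  intro d hd
  have hl2 : 0 < l ^ 2 := by positivity
  have := (h (d / l ^ 2) (by rwa [div_lt_iff₀' hl2])).smul l
  rwa [mul_div_cancel₀ _ hl2.ne'] at this

theorem CetBelow.concat {h : ℝ} (hy : CetBelow m M y₁ y₂ y₃ c)
    (hw : CetBelow m M w₁ w₂ w₃ d) (hm : 0 ≤ m) (hy₃ : m ≤ y₃) (hw₃ : m ≤ w₃) (hh : 0 ≤ h)
    (hM : (y₃ + w₃) / 2 + h ≤ M) :
    CetBelow m M ((y₁ + w₁) / 2) ((y₂ + w₂) / 2) ((y₃ + w₃) / 2 + h)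
      ((c + d) / 2 + ((y₁ + w₁) / 2) ^ 2 * h) := by
  intro e he
  set δ := (c + d) / 2 + ((y₁ + w₁) / 2) ^ 2 * h - e with hδ
  refine ((hy (c - δ) (by linarith)).concat (hw (d - δ) (by linarith)) hm hy₃ hw₃ hh hM).mono
    (le_of_eq ?_)
  rw [hδ]
  ring

theorem CetBelow.midpoint (hy : CetBelow m M y₁ y₂ y₃ c) (hw : CetBelow m M w₁ w₂ w₃ d)
    (hm : 0 ≤ m) (hy₃ : y₃ ∈ Icc m M) (hw₃ : w₃ ∈ Icc m M) :
    CetBelow m M ((y₁ + w₁) / 2) ((y₂ + w₂) / 2) ((y₃ + w₃) / 2) ((c + d) / 2) := by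
  simpa using hy.concat hw hm hy₃.1 hw₃.1 le_rfl (by linarith [hy₃.2, hw₃.2])

/-- Take `φ` constant on each half, equal to `x₁ ± √(x₂ - x₁²)`, with `μ` of uniform density `x₃`.
-/
theorem cetBelow_mul (hm : 0 ≤ m) (hx₃ : x₃ ∈ Icc m M) (hx : x₁ ^ 2 ≤ x₂) :
    CetBelow m M x₁ x₂ x₃ (x₃ * x₂) := by
  have h := (cetReach_const hx₃.1 hx₃.2 (x₁ + √(x₂ - x₁ ^ 2))).below.midpoint
    (cetReach_const hx₃.1 hx₃.2 (x₁ - √(x₂ - x₁ ^ 2))).below hm hx₃ hx₃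
  have hs := Real.sq_sqrt (sub_nonneg.2 hx)
  convert h using 1
  · ring
  · linear_combination -hs
  · ring
  · linear_combination (-x₃) * hs

/-- Only midpoints are available directly. A parameter `s` is the midpoint of an endpoint and of
`2s` or `2s - 1`; following its binary digits for `n` steps and stopping with `cetBelow_mul` costs
at most `(|c| + |d|) / 2 ^ n`. -/
theorem CetBelow.convex_comb (hy : CetBelow m M y₁ y₂ y₃ c) (hw : CetBelow m M w₁ w₂ w₃ d)
    (hm : 0 ≤ m) (hy₃ : y₃ ∈ Icc m M) (hw₃ : w₃ ∈ Icc m M) (hy₂ : y₁ ^ 2 ≤ y₂)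
    (hw₂ : w₁ ^ 2 ≤ w₂) {t : ℝ} (ht : t ∈ Icc (0 : ℝ) 1) :
    CetBelow m M ((1 - t) * y₁ + t * w₁) ((1 - t) * y₂ + t * w₂) ((1 - t) * y₃ + t * w₃)
      ((1 - t) * c + t * d) := by
  have hmem : ∀ s ∈ Icc (0 : ℝ) 1, (1 - s) * y₃ + s * w₃ ∈ Icc m M := fun s hs =>
    (convex_Icc m M) hy₃ hw₃ (by linarith [hs.2]) hs.1 (by ring)
  have hn : ∀ n : ℕ, ∀ s ∈ Icc (0 : ℝ) 1,
      CetBelow m M ((1 - s) * y₁ + s * w₁) ((1 - s) * y₂ + s * w₂) ((1 - s) * y₃ + s * w₃)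
      ((1 - s) * c + s * d - (|c| + |d|) * (1 / 2) ^ n) := by
    intro n
    induction n with
    | zero =>
      intro s hs
      have hsq : ((1 - s) * y₁ + s * w₁) ^ 2 ≤ (1 - s) * y₂ + s * w₂ := by
        have := mul_le_mul_of_nonneg_left hy₂ (sub_nonneg.2 hs.2)
        have := mul_le_mul_of_nonneg_left hw₂ hs.1
        nlinarith [mul_nonneg (mul_nonneg hs.1 (sub_nonneg.2 hs.2)) (sq_nonneg (y₁ - w₁))]
      refine (cetBelow_mul hm (hmem s hs) hsq).mono ?_
      have h0 : 0 ≤ ((1 - s) * y₃ + s * w₃) * ((1 - s) * y₂ + s * w₂) :=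
        mul_nonneg (hm.trans (hmem s hs).1) ((sq_nonneg _).trans hsq)
      have hc : (1 - s) * c ≤ |c| := by
        nlinarith [le_abs_self c, abs_nonneg c, hs.1, hs.2]
      have hd : s * d ≤ |d| := by
        nlinarith [le_abs_self d, abs_nonneg d, hs.1, hs.2]
      simp only [pow_zero, mul_one]
      linarith
    | succ n ih =>
      intro s hs
      have hK : 0 ≤ (|c| + |d|) * (1 / 2) ^ n := by positivity
      rcases le_total s (1 / 2) with h | h
      · have hs' : 2 * s ∈ Icc (0 : ℝ) 1 := ⟨by linarith [hs.1], by linarith⟩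
        convert hy.midpoint (ih _ hs') hm hy₃ (hmem _ hs') using 1 <;> ring
      · have hs' : 2 * s - 1 ∈ Icc (0 : ℝ) 1 := ⟨by linarith, by linarith [hs.2]⟩
        convert hw.midpoint (ih _ hs') hm hw₃ (hmem _ hs') using 1 <;> ring
  refine CetBelow.of_tendsto ?_ fun n => hn n t ht
  have := (tendsto_pow_atTop_nhds_zero_of_lt_one (r := (1 / 2 : ℝ)) (by norm_num)
      (by norm_num)).const_mul (|c| + |d|)
  simpa using this.const_sub ((1 - t) * c + t * d)

end

/-! ### The face `x₃ = M` -/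

section top

variable {m M y₁ y₂ κ : ℝ}

/-- One self-similar step at the top of the domain, iterated to its fixed point. -/
theorem cetBelow_top_step (hm : 0 ≤ m) (hmM : m ≤ M) (hκ : κ ∈ Ico (0 : ℝ) (1 / 2))
    (hy : y₁ ^ 2 ≤ y₂) (hr : y₁ ^ 2 * (1 - κ) ^ 2 = (1 - 2 * κ) * y₂) {p : ℝ}
    (hp : p ∈ Ioo (0 : ℝ) 1) :
    CetBelow m M y₁ y₂ M
      (m * y₂ + (M - m) * y₁ ^ 2 / (1 - 2 * κ + p * (2 * κ - κ ^ 2) + p ^ 2 * κ ^ 2)) := by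
  obtain ⟨hκ0, hκ1⟩ := hκ
  obtain ⟨hp0, hp1⟩ := hp
  -- A fraction `1 - p` carries the data `(l y₁, l² y₂, M)`, the rest `((1-κ+κp) y₁, e y₂, m)`; `e`
  -- is fixed by preservation of the second moment, `p e + (1-p) l² = 1`.
  set e := 1 - 2 * κ + p * (2 * κ - κ ^ 2) + p ^ 2 * κ ^ 2 with he
  set l := 1 + κ * p with hl
  have hy₂ : 0 ≤ y₂ := (sq_nonneg _).trans hy
  have he0 : 0 < e := by
    have : 0 ≤ p * (2 * κ - κ ^ 2) := mul_nonneg hp0.le (by nlinarith)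
    have : 0 ≤ p ^ 2 * κ ^ 2 := by positivity
    linarith
  have hl0 : 0 < l := by positivity
  have hρ : (1 - p) * l ^ 2 = 1 - p * e := by rw [hl, he]; ring
  have hρ0 : 0 ≤ 1 - p * e := by rw [← hρ]; exact mul_nonneg (by linarith) (by positivity)
  have hρ1 : 1 - p * e < 1 := by linarith [mul_pos hp0 he0]
  -- The part of density `m` must satisfy Cauchy–Schwarz. By `hr` this is an equality at `p = 0`,
  -- and for `p > 0` there is slack.
  have hξ : ((1 - κ + κ * p) * y₁) ^ 2 ≤ e * y₂ := by
    have h1 : e * y₂ - ((1 - κ + κ * p) * y₁) ^ 2 =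
        (2 * (1 - κ) * κ * p + κ ^ 2 * p ^ 2) * (y₂ - y₁ ^ 2) + p * κ ^ 2 * y₂ := by
      rw [he]
      linear_combination -hr
    have h2 : 0 ≤ (2 * (1 - κ) * κ * p + κ ^ 2 * p ^ 2) * (y₂ - y₁ ^ 2) := by
      refine mul_nonneg (add_nonneg ?_ (by positivity)) (by linarith)
      exact mul_nonneg (mul_nonneg (by linarith) hκ0) hp0.le
    have h3 : 0 ≤ p * κ ^ 2 * y₂ := by positivity
    linarith
  set C := m * y₂ + (M - m) * y₁ ^ 2 / e with hC
  -- `C` is the fixed point of one step `c ↦ p m e y₂ + (1-p) l² c + y₁² p (M-m)`, a contraction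
  -- with factor `1 - p e`.
  have hCe : C * (p * e) = p * m * (e * y₂) + y₁ ^ 2 * (p * (M - m)) := by
    rw [hC]
    field_simp
  have hn : ∀ n : ℕ, CetBelow m M y₁ y₂ M (C * (1 - (1 - p * e) ^ n)) := by
    intro n
    induction n with
    | zero =>
      refine (cetBelow_mul hm ⟨hmM, le_rfl⟩ hy).mono ?_
      simpa using mul_nonneg (hm.trans hmM) hy₂
    | succ n ih =>
      have h1 := (cetBelow_mul hm ⟨le_rfl, hmM⟩ hξ).convex_comb (ih.smul hl0) hm ⟨le_rfl, hmM⟩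
        ⟨hmM, le_rfl⟩ hξ (by rw [mul_pow]; gcongr) (t := 1 - p) ⟨by linarith, by linarith⟩
      have h2 : m ≤ (1 - (1 - p)) * m + (1 - p) * M := by nlinarith
      -- Both halves get the same mixture, of density `M - p(M-m)`; the missing mass sits on `I`.
      have h3 := h1.concat h1 hm h2 h2 (h := p * (M - m)) (mul_nonneg hp0.le (by linarith))
        (by linarith)
      have e1 : (1 - (1 - p)) * ((1 - κ + κ * p) * y₁) + (1 - p) * (l * y₁) = y₁ := by
        rw [hl]; ring
      have e2 : (1 - (1 - p)) * (e * y₂) + (1 - p) * (l ^ 2 * y₂) = y₂ := by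
        linear_combination y₂ * hρ
      have e3 : (1 - (1 - p)) * m + (1 - p) * M + p * (M - m) = M := by ring
      rw [e1, e2, add_self_div_two, add_self_div_two, add_self_div_two, add_self_div_two, e3] at h3
      convert h3 using 1
      rw [pow_succ]
      linear_combination hCe - C * (1 - (1 - p * e) ^ n) * hρ
  refine CetBelow.of_tendsto ?_ hn
  simpa using ((tendsto_pow_atTop_nhds_zero_of_lt_one hρ0 hρ1).const_sub 1).const_mul C

theorem cetBelow_top_of_lt (hm : 0 ≤ m) (hmM : m ≤ M) (hκ : κ ∈ Ico (0 : ℝ) (1 / 2))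
    (hy : y₁ ^ 2 ≤ y₂) (hr : y₁ ^ 2 * (1 - κ) ^ 2 = (1 - 2 * κ) * y₂) :
    CetBelow m M y₁ y₂ M (m * y₂ + (M - m) * y₂ / (1 - κ) ^ 2) := by
  have hκ1 : 0 < 1 - 2 * κ := by linarith [hκ.2]
  have hκ2 : 0 < 1 - κ := by linarith [hκ.1]
  have hv : m * y₂ + (M - m) * y₂ / (1 - κ) ^ 2 = m * y₂ + (M - m) * y₁ ^ 2 /
      (1 - 2 * κ + 0 * (2 * κ - κ ^ 2) + 0 ^ 2 * κ ^ 2) := by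
    have : 1 - 2 * κ + 0 * (2 * κ - κ ^ 2) + 0 ^ 2 * κ ^ 2 = 1 - 2 * κ := by ring
    rw [this]
    congr 1
    rw [div_eq_div_iff (by positivity) hκ1.ne']
    linear_combination -(M - m) * hr
  rw [hv]
  have hlim := tendsto_one_div_add_atTop_nhds_zero_nat (𝕜 := ℝ)
  -- Let `p = 1/(n+2)` tend to `0`; the shift keeps `p < 1` at `n = 0`.
  refine CetBelow.of_tendsto (f := fun n : ℕ => m * y₂ + (M - m) * y₁ ^ 2 /
    (1 - 2 * κ + (1 / ((n + 1 : ℕ) + 1 : ℝ)) * (2 * κ - κ ^ 2) +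
      (1 / ((n + 1 : ℕ) + 1 : ℝ)) ^ 2 * κ ^ 2)) ?_ fun n => ?_
  · have hp := hlim.comp (tendsto_add_atTop_nat 1)
    refine (Tendsto.div tendsto_const_nhds (((hp.mul_const _).const_add _).add
      ((hp.pow 2).mul_const _)) ?_).const_add _
    simpa using hκ1.ne'
  · refine cetBelow_top_step hm hmM hκ hy hr ⟨by positivity, ?_⟩
    rw [div_lt_one (by positivity)]
    push_cast
    have : (0 : ℝ) ≤ n := n.cast_nonneg
    linarith

theorem cetBelow_top (hm : 0 ≤ m) (hmM : m ≤ M) (hκ : κ ∈ Icc (0 : ℝ) (1 / 2))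
    (hy : y₁ ^ 2 ≤ y₂) (hr : y₁ ^ 2 * (1 - κ) ^ 2 = (1 - 2 * κ) * y₂) :
    CetBelow m M y₁ y₂ M (m * y₂ + (M - m) * y₂ / (1 - κ) ^ 2) := by
  rcases hκ.2.lt_or_eq with h | rfl
  · exact cetBelow_top_of_lt hm hmM ⟨hκ.1, h⟩ hy hr
  have hy₁ : y₁ = 0 := by
    have : y₁ ^ 2 = 0 := by linarith
    simpa using this
  subst hy₁
  have hy₂ : 0 ≤ y₂ := by simpa using hy
  have hlim := (tendsto_one_div_add_atTop_nhds_zero_nat (𝕜 := ℝ)).comp (tendsto_add_atTop_nat 1)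
  have hk : Tendsto (fun n : ℕ => 1 / 2 - 1 / ((n + 1 : ℕ) + 1 : ℝ)) atTop (𝓝 (1 / 2)) := by
    simpa using hlim.const_sub (1 / 2 : ℝ)
  refine CetBelow.of_tendsto (f := fun n : ℕ => m * y₂ + (M - m) * y₂ /
    (1 - (1 / 2 - 1 / ((n + 1 : ℕ) + 1 : ℝ))) ^ 2) ?_ fun n => ?_
  · exact (Tendsto.div tendsto_const_nhds ((hk.const_sub 1).pow 2) (by norm_num)).const_add _
  · set q := 1 / ((n + 1 : ℕ) + 1 : ℝ) with hq
    have hq0 : 0 < q := by positivity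
    have hq1 : q ≤ 1 / 2 := by
      rw [hq]
      refine one_div_le_one_div_of_le (by norm_num) ?_
      push_cast
      have : (0 : ℝ) ≤ n := n.cast_nonneg
      linarith
    have hk0 : 0 < 1 - (1 / 2 - q) := by linarith
    -- For `κ = 1/2` the mean is `0` and one step gains nothing. Instead the means `±ε` on the two
    -- halves are used, with `ε` solving the relation for `κ = 1/2 - q`.
    set ε := √(2 * q * y₂) / (1 - (1 / 2 - q)) with hε
    have hε2 : ε ^ 2 * (1 - (1 / 2 - q)) ^ 2 = (1 - 2 * (1 / 2 - q)) * y₂ := by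
      rw [hε, div_pow, Real.sq_sqrt (by positivity), div_mul_cancel₀ _ (by positivity)]
      ring
    have hεle : ε ^ 2 ≤ y₂ := by
      have h1 : ε ^ 2 * (1 - (1 / 2 - q)) ^ 2 ≤ y₂ * (1 - (1 / 2 - q)) ^ 2 := by
        rw [hε2, mul_comm y₂]
        gcongr
        nlinarith [sq_nonneg (1 / 2 - q)]
      exact le_of_mul_le_mul_right h1 (by positivity)
    have hmem : 1 / 2 - q ∈ Ico (0 : ℝ) (1 / 2) := ⟨by linarith, by linarith⟩
    have h1 := cetBelow_top_of_lt hm hmM hmem hεle hε2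
    have h2 := cetBelow_top_of_lt (y₁ := -ε) (y₂ := y₂) hm hmM hmem (by rwa [neg_sq]) (by rwa [neg_sq])
    have h3 := h1.midpoint h2 hm ⟨hmM, le_rfl⟩ ⟨hmM, le_rfl⟩
    simpa using h3

end top

/-! ### The cubic equation -/

/-- The right-hand side of the cubic equation, with `D = M - m` and `s = M - x₃`. -/
noncomputable def cetRatio (D s a : ℝ) : ℝ :=
  ((1 - 2 * a * s) / (1 - 2 * a * D)) ^ 2 * ((1 - 4 * a * D) / (1 - 4 * a * s))

/-- Monotonicity of `cetRatio` in the variable `1/(2a)`, with denominators cleared. In the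
successive gaps between `s`, `D`, `b/2`, and between `b` and `c`, the difference has only positive
coefficients. -/
theorem cetRatio_aux {D s b c : ℝ} (hs : 0 ≤ s) (hsD : s < D) (hb : 2 * D ≤ b) (hbc : b < c) :
    (b - s) ^ 2 * (b - 2 * D) * ((c - D) ^ 2 * (c - 2 * s)) <
      (c - s) ^ 2 * (c - 2 * D) * ((b - D) ^ 2 * (b - 2 * s)) := by
  obtain ⟨e, rfl⟩ : ∃ e, D = s + e := ⟨D - s, by ring⟩
  obtain ⟨β, rfl⟩ : ∃ β, b = 2 * (s + e) + β := ⟨b - 2 * (s + e), by ring⟩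
  obtain ⟨γ, rfl⟩ : ∃ γ, c = 2 * (s + e) + β + γ := ⟨c - (2 * (s + e) + β), by ring⟩
  have he : 0 < e := by linarith
  have hβ : 0 ≤ β := by linarith
  have hγ : 0 < γ := by linarith
  rw [← sub_pos]
  have : 0 < e * γ * (2 * s ^ 4 + 12 * s ^ 3 * e + 8 * s ^ 3 * β + 4 * s ^ 3 * γ + 26 * s ^ 2 * e ^ 2 +
      32 * s ^ 2 * e * β + 16 * s ^ 2 * e * γ + 10 * s ^ 2 * β ^ 2 + 10 * s ^ 2 * β * γ +
      2 * s ^ 2 * γ ^ 2 + 24 * s * e ^ 3 + 40 * s * e ^ 2 * β + 20 * s * e ^ 2 * γ +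
      22 * s * e * β ^ 2 + 22 * s * e * β * γ + 4 * s * e * γ ^ 2 + 4 * s * β ^ 3 +
      6 * s * β ^ 2 * γ + 2 * s * β * γ ^ 2 + 8 * e ^ 4 + 16 * e ^ 3 * β + 8 * e ^ 3 * γ +
      10 * e ^ 2 * β ^ 2 + 10 * e ^ 2 * β * γ + 2 * e ^ 2 * γ ^ 2 + 2 * e * β ^ 3 +
      3 * e * β ^ 2 * γ + 1 * e * β * γ ^ 2) := by positivity
  refine this.trans_eq ?_
  ring

theorem cetRatio_lt {D s a b : ℝ} (hs : 0 ≤ s) (hsD : s < D) (ha : 0 ≤ a) (hab : a < b)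
    (hb : 4 * b * D ≤ 1) : cetRatio D s b < cetRatio D s a := by
  have hb0 : 0 < b := ha.trans_lt hab
  have hD : 0 < D := hs.trans_lt hsD
  have hbs : b * s < b * D := mul_lt_mul_of_pos_left hsD hb0
  have haD : a * D < b * D := mul_lt_mul_of_pos_right hab hD
  have has : a * s ≤ a * D := mul_le_mul_of_nonneg_left hsD.le ha
  have hpa : 0 < (1 - 2 * a * D) ^ 2 * (1 - 4 * a * s) :=
    mul_pos (pow_pos (by linarith) 2) (by linarith)
  have hpb : 0 < (1 - 2 * b * D) ^ 2 * (1 - 4 * b * s) :=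
    mul_pos (pow_pos (by linarith) 2) (by linarith)
  rw [cetRatio, cetRatio, div_pow, div_pow, div_mul_div_comm, div_mul_div_comm,
    div_lt_div_iff₀ hpb hpa]
  -- The substitution `1/(2a)` is unavailable at `a = 0`, where the difference factors directly.
  rcases ha.eq_or_lt with rfl | ha0
  · have h1 : 0 < b ^ 2 * (D - s) * (D + s - 4 * (b * D) * s) := by
      refine mul_pos (mul_pos (by positivity) (by linarith)) ?_
      nlinarith
    nlinarith
  · have key := cetRatio_aux hs hsD (b := 1 / (2 * b)) (c := 1 / (2 * a))
      (by rw [le_div_iff₀ (by positivity)]; linarith) (by gcongr)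
    have e : ∀ r t : ℝ, 0 < r → 1 / (2 * r) - t = (1 - 2 * r * t) / (2 * r) := fun r t hr => by
      field_simp
    rw [e _ _ hb0, e _ _ hb0, e _ _ hb0, e _ _ ha0, e _ _ ha0, e _ _ ha0] at key
    have hk : 0 < (2 * a) ^ 3 * (2 * b) ^ 3 := by positivity
    have := mul_lt_mul_of_pos_right key hk
    convert this using 1 <;> field_simp <;> ring

theorem existsUnique_cetRoot {m M x₁ x₂ x₃ : ℝ} (hx : x₁ ^ 2 ≤ x₂) (hx₂ : 0 < x₂) (hmx : m < x₃)
    (hxM : x₃ ≤ M) : ∃! a, IsCetRoot x₁ x₂ x₃ m M a := by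
  have hD : 0 < M - m := by linarith
  have hs : 0 ≤ M - x₃ := by linarith
  have hsD : M - x₃ < M - m := by linarith
  have hle : ∀ a ∈ Icc 0 (1 / (4 * (M - m))), 4 * a * (M - m) ≤ 1 := fun a ha => by
    have := ha.2
    rw [le_div_iff₀ (by positivity)] at this
    linarith
  have hlt : ∀ a ∈ Icc 0 (1 / (4 * (M - m))), 4 * a * (M - x₃) < 1 := fun a ha => by
    rcases ha.1.eq_or_lt with h | h
    · simp [← h]
    · nlinarith [hle a ha]
  have hcont : ContinuousOn (cetRatio (M - m) (M - x₃)) (Icc 0 (1 / (4 * (M - m)))) := by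
    refine ContinuousOn.mul (ContinuousOn.pow (ContinuousOn.div (by fun_prop) (by fun_prop)
      fun a ha => ?_) 2) (ContinuousOn.div (by fun_prop) (by fun_prop) fun a ha => ?_)
    · linarith [hle a ha]
    · linarith [hlt a ha]
  have h0 : cetRatio (M - m) (M - x₃) 0 = 1 := by simp [cetRatio]
  have h1 : cetRatio (M - m) (M - x₃) (1 / (4 * (M - m))) = 0 := by
    have : 1 - 4 * (1 / (4 * (M - m))) * (M - m) = 0 := by field_simp; ring
    rw [cetRatio, this, zero_div, mul_zero]
  obtain ⟨a, ha, hroot⟩ := intermediate_value_Icc' (by positivity) hcont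
    (show x₁ ^ 2 / x₂ ∈ _ by
      rw [h0, h1]
      exact ⟨by positivity, (div_le_one hx₂).2 hx⟩)
  refine ⟨a, ⟨ha, hroot.symm⟩, fun b hb => ?_⟩
  have hbroot : cetRatio (M - m) (M - x₃) b = cetRatio (M - m) (M - x₃) a := hb.2.symm.trans
    hroot.symm
  rcases lt_trichotomy a b with h | h | h
  · exact absurd hbroot (cetRatio_lt hs hsD ha.1 h (hle b hb.1)).ne
  · exact h.symm
  · exact absurd hbroot (cetRatio_lt hs hsD hb.1.1 h (hle a ha)).ne'

/-! ### The formula -/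

theorem IsCetRoot.mul_eq {m M x₁ x₂ x₃ a : ℝ} (hx₂ : 0 < x₂) (hmx : m < x₃) (hxM : x₃ ≤ M)
    (ha : IsCetRoot x₁ x₂ x₃ m M a) :
    0 ≤ a ∧ 0 ≤ 1 - 4 * a * (M - m) ∧ 0 < 1 - 2 * a * (M - m) ∧ 0 < 1 - 4 * a * (M - x₃) ∧
      0 < 1 - 2 * a * (M - x₃) ∧
      x₁ ^ 2 * ((1 - 2 * a * (M - m)) ^ 2 * (1 - 4 * a * (M - x₃))) =
        x₂ * ((1 - 2 * a * (M - x₃)) ^ 2 * (1 - 4 * a * (M - m))) := by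
  obtain ⟨⟨ha0, ha1⟩, hr⟩ := ha
  have hD : 0 < M - m := by linarith
  rw [le_div_iff₀ (by positivity)] at ha1
  have h1 : 0 < 1 - 4 * a * (M - x₃) := by
    rcases ha0.eq_or_lt with h | h
    · simp [← h]
    · nlinarith
  have h2 : 0 < 1 - 2 * a * (M - m) := by linarith
  refine ⟨ha0, by linarith, h2, h1, by linarith, ?_⟩
  rw [div_pow, div_mul_div_comm, div_eq_div_iff hx₂.ne' (by positivity)] at hr
  rw [hr]
  ring

theorem cetFormula_nonneg {m M x₁ x₂ x₃ a : ℝ} (hm : 0 ≤ m) (hx₂ : 0 < x₂) (hmx : m < x₃)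
    (hxM : x₃ ≤ M) (ha : IsCetRoot x₁ x₂ x₃ m M a) : 0 ≤ cetFormula x₂ x₃ m M a := by
  obtain ⟨-, -, h2, h3, -, -⟩ := ha.mul_eq hx₂ hmx hxM
  have : 0 < x₃ - m := by linarith
  unfold cetFormula
  positivity

theorem IsCetRoot.le_cetBellman {m M x₁ x₂ x₃ a u v : ℝ} (hm : 0 ≤ m)
    (hx₂ : 0 < x₂) (hmx : m < x₃) (hxM : x₃ ≤ M) (ha : IsCetRoot x₁ x₂ x₃ m M a) (huv : u < v) :
    ENNReal.ofReal (cetFormula x₂ x₃ m M a) ≤ cetBellman u v x₁ x₂ x₃ m M := by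
  obtain ⟨ha0, hF, hE, hB, hA, hr⟩ := ha.mul_eq hx₂ hmx hxM
  have hD : 0 < M - m := by linarith
  have hmM : m ≤ M := by linarith
  set A := 1 - 2 * a * (M - x₃) with hAd
  set B := 1 - 4 * a * (M - x₃) with hBd
  set E := 1 - 2 * a * (M - m) with hEd
  set F := 1 - 4 * a * (M - m) with hFd
  have hy : (x₁ / A) ^ 2 * E ^ 2 = F * (x₂ / B) := by
    field_simp
    linear_combination hr
  have hFE : F ≤ E ^ 2 := by nlinarith [sq_nonneg (a * (M - m))]
  have hle : (x₁ / A) ^ 2 ≤ x₂ / B := by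
    have : (x₁ / A) ^ 2 * E ^ 2 ≤ x₂ / B * E ^ 2 := by
      rw [hy, mul_comm]
      gcongr
    exact le_of_mul_le_mul_right this (by positivity)
  have hκ : 1 - 2 * a * (M - m) = E ∧ 1 - 2 * (2 * a * (M - m)) = F := ⟨rfl, by ring⟩
  -- `x` is the convex combination of the top point `(x₁/A, x₂/B, M)` and the bottom point `(E x₁/A,
  -- F x₂/B, m)`. The cubic equation says that the bottom point lies on the parabola, which is the
  -- relation `cetBelow_top` requires.
  have htop := cetBelow_top (κ := 2 * a * (M - m)) hm hmM ⟨by positivity, by linarith⟩ hle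
    (by rw [hκ.1, hκ.2, hy])
  have hξ : (E * (x₁ / A)) ^ 2 ≤ F * (x₂ / B) := by rw [← hy, mul_pow, mul_comm]
  have hc := (cetBelow_mul hm ⟨le_rfl, hmM⟩ hξ).convex_comb htop hm ⟨le_rfl, hmM⟩ ⟨hmM, le_rfl⟩
    hξ hle (t := (x₃ - m) / (M - m))
    ⟨div_nonneg (by linarith) hD.le, (div_le_one hD).2 (by linarith)⟩
  refine CetBelow.le_cetBellman ?_ huv
  have ht : (x₃ - m) / (M - m) * (M - m) = x₃ - m := div_mul_cancel₀ _ hD.ne'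
  set t := (x₃ - m) / (M - m)
  have hx₂' : x₂ / B * B = x₂ := div_mul_cancel₀ _ hB.ne'
  have hx₁' : x₁ / A * A = x₁ := div_mul_cancel₀ _ hA.ne'
  convert hc using 1
  · rw [hEd]
    nth_rw 1 [← hx₁']
    linear_combination (x₁ / A) * (hAd + (-2 * a) * ht)
  · rw [hFd]
    nth_rw 1 [← hx₂']
    linear_combination (x₂ / B) * (hBd + (-4 * a) * ht)
  · linear_combination -ht
  · rw [cetFormula, ← hEd, ← hBd]
    have e1 : (x₃ - m) * x₂ / (E ^ 2 * B) = (x₃ - m) * (x₂ / B) / E ^ 2 := by field_simp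
    have e2 : x₂ = (1 - t) * (F * (x₂ / B)) + t * (x₂ / B) := by
      rw [hFd]
      nth_rw 1 [← hx₂']
      linear_combination (x₂ / B) * (hBd + (-4 * a) * ht)
    rw [e1, ← ht]
    linear_combination m * e2

theorem IsCetRoot.cetBellman_le {m M x₁ x₂ x₃ a u v : ℝ} (hm : 0 ≤ m)
    (hx₂ : 0 < x₂) (hmx : m < x₃) (hxM : x₃ ≤ M) (ha : IsCetRoot x₁ x₂ x₃ m M a) (huv : u < v) :
    cetBellman u v x₁ x₂ x₃ m M ≤ ENNReal.ofReal (cetFormula x₂ x₃ m M a) := by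
  obtain ⟨ha0, hF, hE, hB, hA, hr⟩ := ha.mul_eq hx₂ hmx hxM
  have hD : 0 < M - m := by linarith
  have hmM : m ≤ M := by linarith
  have hx₃ : 0 ≤ x₃ := by linarith
  rcases ha0.eq_or_lt with h | h
  · subst h
    have hx : x₁ ^ 2 = x₂ := by simpa using hr
    have hlim : Tendsto (fun z : ℝ => m * x₂ +
        x₂ * (x₃ - m) / ((1 - z * (M - m)) * (1 - z * (M - x₃)))) (𝓝[>] 0)
        (𝓝 (cetFormula x₂ x₃ m M 0)) := by
      have : ContinuousAt (fun z : ℝ => m * x₂ +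
          x₂ * (x₃ - m) / ((1 - z * (M - m)) * (1 - z * (M - x₃)))) 0 :=
        ContinuousAt.add continuousAt_const (ContinuousAt.div continuousAt_const
          (by fun_prop) (by simp))
      have h0 := this.tendsto.mono_left (nhdsWithin_le_nhds (s := Ioi 0))
      convert h0 using 2
      simp [cetFormula]
      ring
    refine ge_of_tendsto (ENNReal.tendsto_ofReal hlim) ?_
    filter_upwards [Ioo_mem_nhdsGT (show 0 < 1 / (M - m) by positivity)] with z hz
    have hzM : z * (M - m) < 1 := (lt_div_iff₀ hD).1 hz.2
    refine (_root_.cetBellman_le hm hmM hz.1 hzM huv hx₃).trans_eq ?_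
    congr 1
    have h1 : 0 < 1 - z * (M - m) := by linarith
    have h2 : 0 < 1 - z * (M - x₃) := by nlinarith [hz.1]
    have hz0 := hz.1
    rw [cetMajorant, if_neg hmx.ne', hx]
    congr 1
    field_simp
    ring
  -- `z = 2a` is the stationary point, where the cubic turns the majorant into the formula.
  · refine (_root_.cetBellman_le hm hmM (z := 2 * a) (by positivity) (by linarith) huv hx₃).trans_eq
      ?_
    congr 1
    rw [cetMajorant, if_neg hmx.ne', cetFormula, add_comm]
    congr 1
    rw [div_sub_div _ _ (by positivity) (by positivity), div_eq_div_iff (by positivity)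
      (by positivity)]
    linear_combination (-(2 * a) * (1 - 2 * a * (M - m))) * hr

theorem mainTheorem1 (u v : ℝ) (huv : u < v) (m M : ℝ) (hm : 0 ≤ m)
    (x₁ x₂ x₃ : ℝ) (hx : x₁ ^ 2 ≤ x₂) (hmx : m ≤ x₃) (hxM : x₃ ≤ M) :
    (m < x₃ → 0 < x₂ →
      (∃! a : ℝ, IsCetRoot x₁ x₂ x₃ m M a) ∧
      ∀ a : ℝ, IsCetRoot x₁ x₂ x₃ m M a →
        0 ≤ cetFormula x₂ x₃ m M a ∧
        cetBellman u v x₁ x₂ x₃ m M = ENNReal.ofReal (cetFormula x₂ x₃ m M a)) ∧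
    (m < x₃ → x₂ = 0 → cetBellman u v x₁ x₂ x₃ m M = 0) ∧
    (x₃ = m → cetBellman u v x₁ x₂ x₃ m M = ENNReal.ofReal (m * x₂)) := by
  have hmM := hmx.trans hxM
  refine ⟨fun h h₂ => ⟨existsUnique_cetRoot hx h₂ h hxM, fun a ha =>
    ⟨cetFormula_nonneg hm h₂ h hxM ha, le_antisymm (ha.cetBellman_le hm h₂ h hxM huv)
      (ha.le_cetBellman hm h₂ h hxM huv)⟩⟩, fun h h₂ => ?_, fun h => ?_⟩
  all_goals
    have hD : 0 ≤ M - m := by linarith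
    -- Any admissible `z` serves, since in both cases the majorant does not depend on it; the `+ 1`
    -- allows `M = m`.
    have hz : 0 < 1 / (M - m + 1) := by positivity
    have hzM : 1 / (M - m + 1) * (M - m) < 1 := by
      rw [one_div_mul_eq_div, div_lt_one (by linarith)]
      linarith
    have hle := cetBellman_le (x₁ := x₁) (x₂ := x₂) hm hmM hz hzM huv (hm.trans hmx)
  · subst h₂
    have hx₁ : x₁ = 0 := by
      simpa using hx.antisymm (sq_nonneg x₁)
    simpa [cetMajorant, hx₁] using hle
  · subst h
    refine le_antisymm (by simpa [cetMajorant] using hle) ?_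
    exact (cetBelow_mul hm ⟨le_rfl, hxM⟩ hx).le_cetBellman huv
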